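/- Graphs are finite. A plane graph is a graph embedded in the plane without crossings (considered up to homeomorphism, that is, given by the counterclockwise cyclic ordering of the edges around each vertex together with the facial walks that bound the outer face). An outerplane graph is a plane graph all of whose vertices are incident to the outer face; an inner face is a face other than the outer one, and $V(F)$ is the set of vertices on the boundary of the face $F$. A $2$-connected component of $G$ is a maximal set $H$ of vertices that induces a $2$-connected subgraph (one with more than $2$ vertices that is connected and has no cut vertex). A blocking set of an outerplane graph $G$ is a set $B \subseteq V(G)$ such that $G[H \setminus B]$ is a tree for each $2$-connected component $H$ of $G$, and $V(F) \setminus B \neq \emptyset$ for each inner face $F$ of $G$. The blocking graph $\mathrm{block}_B(G)$ is the multigraph with vertex set $B$ obtained as follows: for each component of $G$ with at least one edge, take the closed facial walk of that component on the outer face, delete from it all vertices not in $B$ to get a cyclic sequence $W'$ of vertices in $B$, and add one edge $uw$ for each consecutive pair $uw$ in $W'$. Thus $\mathrm{block}_B(G)$ may have loops (cycles of length $1$; in particular when $W'$ has a single term) and parallel edges (cycles of length $2$). Lemma. Every simple outerplane graph $G$ (connected or not) has a blocking set $B$ such that every cycle of $\mathrm{block}_B(G)$ has even length. -/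

import Mathlib

/-- `G` is `k`-connected: it has more than `k` vertices and deleting fewer than `k` vertices
never disconnects it. -/
def SimpleGraph.IsKVertexConnected {V : Type*} (G : SimpleGraph V) (k : ℕ) : Prop :=
  k < Nat.card V ∧ ∀ S : Set V, S.ncard < k → (G.induce Sᶜ).Connected

/-- `H` is (the vertex set of) a `k`-connected component of `G`: a maximal set of vertices that
induces a `k`-connected subgraph. -/
def SimpleGraph.IsKConnectedComponent {V : Type*} (G : SimpleGraph V) (k : ℕ)
    (H : Set V) : Prop :=
  Maximal (fun S : Set V => (G.induce S).IsKVertexConnected k) H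

/-- A rotation system: for every vertex `v`, a cyclic ordering (counterclockwise) of the edges
at `v`. An edge at `v` is represented by the dart that leaves `v` along it, and `next d` is the
dart that follows `d` in the cyclic ordering at `d.fst`. -/
structure RotationSystem {V : Type*} (G : SimpleGraph V) where
  next : Equiv.Perm G.Dart
  fst_next : ∀ d, (next d).fst = d.fst
  sameCycle_next : ∀ d e : G.Dart, d.fst = e.fst → next.SameCycle d e

namespace RotationSystem

variable {V : Type*} {G : SimpleGraph V} (R : RotationSystem G)

/-- One step of a facial walk: the walk arrives along `d = (u, v)`, and leaves `v` along the edge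
that follows the edge `vu` in the cyclic ordering at `v`. -/
def faceStep : Equiv.Perm G.Dart :=
  SimpleGraph.Dart.symm_involutive.toPerm.trans R.next

/-- The facial walk through the dart `d`, as the set of darts it traverses. -/
def facialWalk (d : G.Dart) : Set G.Dart :=
  {e | R.faceStep.SameCycle d e}

/-- Euler's formula `|V| - |E| + |F| = 2` for a component `c`. -/
def EulerFormula (c : G.ConnectedComponent) : Prop :=
  c.supp.ncard + (R.facialWalk '' {d | d.fst ∈ c.supp}).ncard
    = {e ∈ G.edgeSet | ∃ v ∈ e, v ∈ c.supp}.ncard + 2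

end RotationSystem

/-- A simple outerplane graph: a simple graph `G` with an embedding in the plane for which all
vertices are incident to the outer face. The embedding is given, up to homeomorphism, by
its rotation system and by the facial walks that bound the outer face.

As all vertices are on the outer face, no component of `G` lies in an inner face of another one.
So the outer face is bounded by exactly one facial walk of each component (the empty
one for an isolated vertex), and every other facial walk is the boundary of one inner face. -/
structure OuterplaneEmbedding {V : Type*} (G : SimpleGraph V) extends RotationSystem G where
  /-- The rotation system is planar. (A component without darts is an isolated vertex.) -/
  planar : ∀ d : G.Dart, toRotationSystem.EulerFormula (G.connectedComponentMk d.fst)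
  /-- The darts traversed by the facial walks of the outer face. -/
  outer : Set G.Dart
  /-- In each component, the outer darts form a single facial walk. -/
  mem_outer_iff : ∀ d e : G.Dart, G.Reachable d.fst e.fst → d ∈ outer →
    (e ∈ outer ↔ e ∈ toRotationSystem.facialWalk d)
  /-- Every (non-isolated) vertex is on the outer face. -/
  exists_mem_outer : ∀ d : G.Dart, ∃ e ∈ outer, e.fst = d.fst

namespace OuterplaneEmbedding

variable {V : Type*} {G : SimpleGraph V} (P : OuterplaneEmbedding G)

/-- `F` is the vertex set of an inner face. -/
def IsInnerFaceVertexSet (F : Set V) : Prop :=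
  ∃ d : G.Dart, d ∉ P.outer ∧ F = (fun e : G.Dart => e.fst) '' P.facialWalk d

/-- `B` is a blocking set: `H - B` is a tree for every 2-connected component `H`, and no inner
face has all its vertices in `B`. -/
def IsBlockingSet (B : Set V) : Prop :=
  (∀ H : Set V, G.IsKConnectedComponent 2 H → (G.induce (H \ B)).IsTree) ∧
    ∀ F : Set V, P.IsInnerFaceVertexSet F → (F \ B).Nonempty

/-- `d` and `e` are consecutive visits of facial walks to the set `B`: after
the visit to `d.fst ∈ B` at the dart `d`, the next visit to `B` is to `e.fst` at the dart `e`. -/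
def NextVisit (B : Set V) (d e : G.Dart) : Prop :=
  d.fst ∈ B ∧ e.fst ∈ B ∧ ∃ n : ℕ, 0 < n ∧ (P.faceStep ^ n) d = e ∧
    ∀ m : ℕ, 0 < m → m < n → ((P.faceStep ^ m) d).fst ∉ B

theorem NextVisit.unique {P : OuterplaneEmbedding G} {B : Set V} {d e e' : G.Dart}
    (h : P.NextVisit B d e) (h' : P.NextVisit B d e') : e = e' := by
  obtain ⟨-, he, n, hn, rfl, hm⟩ := h
  obtain ⟨-, he', n', hn', rfl, hm'⟩ := h'
  rcases lt_trichotomy n n' with hlt | rfl | hlt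
  · exact absurd he (hm' n hn hlt)
  · rfl
  · exact absurd he' (hm n' hn' hlt)

/-- The blocking graph of `B`: the multigraph with vertex set `B` and with one edge for each
consecutive pair in the cyclic sequence that is left of the facial walk on the outer face (of
each component) when the vertices outside `B` are removed. The edge is named by the dart
at which the walk visits the first vertex of the pair. It can be a loop, and edges
can be parallel. -/
def blockingGraph (B : Set V) : Graph V G.Dart where
  vertexSet := B
  IsLink d x y := d ∈ P.outer ∧ ∃ e : G.Dart, P.NextVisit B d e ∧
    ((x = d.fst ∧ y = e.fst) ∨ (x = e.fst ∧ y = d.fst))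
  isLink_symm := by
    intro d _
    refine ⟨?_⟩
    rintro x y ⟨hd, e, he, h⟩
    exact ⟨hd, e, he, by tauto⟩
  eq_or_eq_of_isLink_of_isLink := by
    rintro d x y v w ⟨-, e, he, h⟩ ⟨-, e', he', h'⟩
    obtain rfl := he.unique he'
    rcases h with ⟨rfl, rfl⟩ | ⟨rfl, rfl⟩ <;> rcases h' with ⟨rfl, rfl⟩ | ⟨rfl, rfl⟩ <;> simp
  left_mem_of_isLink := by
    rintro d x y ⟨-, e, he, ⟨rfl, rfl⟩ | ⟨rfl, rfl⟩⟩
    · exact he.1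
    · exact he.2.1

end OuterplaneEmbedding

/-- The multigraph `M` has a cycle of length `n`: distinct vertices `x 0, …, x (n - 1)` and distinct
edges `e 0, …, e (n - 1)` such that `e i` joins `x i` to `x (i + 1)`, with indices modulo `n`.
A loop is a cycle of length `1` and two parallel edges form a cycle of length `2`. -/
def Graph.HasCycleOfLength {α β : Type*} (M : Graph α β) (n : ℕ) : Prop :=
  0 < n ∧ ∃ (x : ZMod n → α) (e : ZMod n → β), Function.Injective x ∧ Function.Injective e ∧
    ∀ i, M.IsLink (e i) (x i) (x (i + 1))

/-! All cycles of the blocking graph are even once some `t : V → ZMod 2` changes along each of its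
edges. It is enough that, along every dart of the outer face, `t` changes exactly when the head of
the dart lies in `B`. The proof constructs `B` and `t` together.

The outer facial walk of a component does not cross itself (`nonCrossing_outer`). It therefore
arises from a trivial walk by repeatedly inserting, at a vertex `x`, either an edge run back and
forth or a cycle that meets the rest only in `x` (`exists_cutsInside`). The potential extends over a
pendant edge if both or neither of its ends are in `B`, and over a cycle if the cycle has an even
number of vertices in `B`. On a cycle, chords separate the enclosed faces. Gluing across chords
gives a set that meets each enclosed face exactly once (`exists_faceCutOnce`), and one extra vertex,
combined with recursion across a chord, corrects the parity (`exists_faceCut_parity`).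

The set `B` blocks for three reasons: every inner face meets `B`, what is left of the face is
connected, and no edge between two inner sides has both ends in `B`. A cycle encloses an inner face
whose vertices are all on the cycle, so none avoids `B`. For connectedness, what is left of each
cycle is connected by gluing along chords, and the cycles in a 2-connected component are linked to
one another.

The interior of a closed walk is encoded as a function on darts with values in `ZMod 2`
(`Encloses`). It exists because, by Euler's formula and a dimension count, the cycle space of a
plane component is spanned by the face boundaries (`exists_separation`). Outerplanarity enters
through `Encloses.eq_zero_of_notMem`. -/

section LinearAlgebra

/-! ### Dimension counts -/

open Module

/-- `A` lies in the orthogonal complement of `C`, and the dimension bound forces equality. -/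
theorem mem_of_forall_dotProduct_eq_zero {K ι : Type*} [Field K] [Fintype ι]
    {A C : Submodule K (ι → K)} (hAC : ∀ a ∈ A, ∀ c ∈ C, a ⬝ᵥ c = 0)
    (hdim : Fintype.card ι ≤ finrank K A + finrank K C) {x : ι → K}
    (hx : ∀ c ∈ C, x ⬝ᵥ c = 0) : x ∈ A := by
  classical
  let e := dotProductEquiv K ι
  have hmem : ∀ y, y ∈ C.dualAnnihilator.comap (e : (ι → K) →ₗ[K] Dual K (ι → K)) ↔
      ∀ c ∈ C, y ⬝ᵥ c = 0 := fun y => by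
    simp [Submodule.mem_dualAnnihilator, e]
  have h1 : finrank K (C.dualAnnihilator.comap (e : (ι → K) →ₗ[K] Dual K (ι → K))) =
      finrank K C.dualAnnihilator := by
    rw [← LinearEquiv.finrank_map_eq e, Submodule.map_comap_eq_of_surjective e.surjective]
  have h2 := Subspace.finrank_add_finrank_dualAnnihilator_eq C
  rw [finrank_pi] at h2
  have h3 : A ≤ C.dualAnnihilator.comap (e : (ι → K) →ₗ[K] Dual K (ι → K)) :=
    fun a ha => (hmem a).2 (hAC a ha)
  rw [Submodule.eq_of_le_of_finrank_le h3 (by omega)]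
  exact (hmem x).2 hx

/-- The kernel contains only constants, so it is at most a line. This serves for the coboundary maps
of a component from faces to edges and from vertices to edges. -/
theorem card_le_finrank_range_add_one {K X M : Type*} [Field K] [Fintype X] [AddCommGroup M]
    [Module K M] (f : (X → K) →ₗ[K] M) (hf : ∀ g, f g = 0 → ∀ x y, g x = g y) :
    Fintype.card X ≤ finrank K (LinearMap.range f) + 1 := by
  have h1 := LinearMap.finrank_range_add_finrank_ker f
  rw [finrank_pi] at h1
  have h2 : LinearMap.ker f ≤ Submodule.span K {fun _ => (1 : K)} := by
    intro g hg
    rcases isEmpty_or_nonempty X with hX | ⟨⟨x⟩⟩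
    · rw [Subsingleton.elim g 0]
      exact zero_mem _
    · refine Submodule.mem_span_singleton.2 ⟨g x, ?_⟩
      ext y
      simp [hf g hg x y]
  have h3 := Submodule.finrank_mono h2
  have h4 := finrank_span_le_card (R := K) ({fun _ => (1 : K)} : Set (X → K))
  simp at h4
  omega

end LinearAlgebra

/-! ### Facial walks and the cycle space modulo 2 -/

namespace RotationSystem

open SimpleGraph

variable {V : Type*} {G : SimpleGraph V} (R : RotationSystem G)

theorem faceStep_apply (d : G.Dart) : R.faceStep d = R.next d.symm := rfl

theorem fst_faceStep (d : G.Dart) : (R.faceStep d).fst = d.snd := by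
  rw [faceStep_apply, R.fst_next]
  rfl

theorem facialWalk_faceStep (d : G.Dart) : R.facialWalk (R.faceStep d) = R.facialWalk d := by
  ext e
  simp [facialWalk]

theorem mem_facialWalk_self (d : G.Dart) : d ∈ R.facialWalk d :=
  Equiv.Perm.SameCycle.refl _ _

theorem facialWalk_eq_of_mem {d e : G.Dart} (h : e ∈ R.facialWalk d) :
    R.facialWalk e = R.facialWalk d := by
  ext f
  exact ⟨fun hf => Equiv.Perm.SameCycle.trans h hf,
    fun hf => Equiv.Perm.SameCycle.trans (Equiv.Perm.SameCycle.symm h) hf⟩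

/-- A function constant along a permutation of a finite set is constant on its cycles. -/
theorem _root_.Equiv.Perm.SameCycle.apply_eq {α β : Type*} {σ : Equiv.Perm α} {f : α → β}
    {s : Set α} (hs : ∀ x ∈ s, σ x ∈ s) (hs' : ∀ x, σ x ∈ s → x ∈ s)
    (hf : ∀ x ∈ s, f (σ x) = f x) {x y : α} (h : σ.SameCycle x y)
    (hx : x ∈ s) : f y = f x ∧ y ∈ s := by
  obtain ⟨n, rfl⟩ := h
  induction n with
  | zero => simp [hx]
  | succ n ih =>
    rw [add_comm, zpow_add, Equiv.Perm.mul_apply, zpow_one]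
    exact ⟨(hf _ ih.2).trans ih.1, hs _ ih.2⟩
  | pred n ih =>
    have h1 : σ ((σ ^ (-(n : ℤ) - 1)) x) = (σ ^ (-(n : ℤ))) x := by
      rw [← Equiv.Perm.mul_apply, ← zpow_one_add]
      congr 2
      ring
    have h2 : (σ ^ (-(n : ℤ) - 1)) x ∈ s := hs' _ (h1 ▸ ih.2)
    refine ⟨?_, h2⟩
    rw [← ih.1, ← h1, hf _ h2]

theorem apply_eq_of_mem_facialWalk {β : Type*} {s : G.Dart → β}
    (hs : ∀ d, s (R.faceStep d) = s d) {d e : G.Dart} (h : e ∈ R.facialWalk d) : s e = s d :=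
  (Equiv.Perm.SameCycle.apply_eq (s := Set.univ) (by simp) (by simp) (fun x _ => hs x) h
    trivial).1

theorem reachable_of_mem_facialWalk {d e : G.Dart} (h : e ∈ R.facialWalk d) :
    G.Reachable d.fst e.fst := by
  rw [← ConnectedComponent.eq]
  refine (R.apply_eq_of_mem_facialWalk (s := fun d => G.connectedComponentMk d.fst) ?_ h).symm
  intro d
  rw [fst_faceStep]
  exact ConnectedComponent.sound d.adj.symm.reachable

/-- A function on darts that does not change along facial walks and on reversal of darts is
constant on each component. -/
theorem apply_eq_of_reachable {β : Type*} {s : G.Dart → β} {c : G.ConnectedComponent}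
    (h1 : ∀ d : G.Dart, d.fst ∈ c.supp → s (R.faceStep d) = s d)
    (h2 : ∀ d : G.Dart, d.fst ∈ c.supp → s d.symm = s d)
    {d e : G.Dart} (hd : d.fst ∈ c.supp) (he : e.fst ∈ c.supp) : s d = s e := by
  have hnext : ∀ x : G.Dart, x.fst ∈ c.supp → s (R.next x) = s x := by
    intro x hx
    have h3 : x.symm.fst ∈ c.supp := by
      rw [ConnectedComponent.mem_supp_iff] at hx ⊢
      rw [← hx]
      exact ConnectedComponent.sound x.adj.symm.reachable
    have := h1 x.symm h3
    rw [faceStep_apply, Dart.symm_symm] at this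
    rw [this, h2 x hx]
  have hvert : ∀ x y : G.Dart, x.fst ∈ c.supp → x.fst = y.fst → s x = s y := by
    intro x y hx hxy
    refine ((Equiv.Perm.SameCycle.apply_eq (s := {z : G.Dart | z.fst ∈ c.supp}) (f := s) ?_ ?_
      hnext (R.sameCycle_next x y hxy) hx).1).symm
    · intro z hz
      simpa [R.fst_next] using hz
    · intro z hz
      simpa [R.fst_next] using hz
  obtain ⟨w⟩ : G.Reachable d.fst e.fst :=
    ConnectedComponent.exact ((c.mem_supp_iff _).1 hd |>.trans ((c.mem_supp_iff _).1 he).symm)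
  have key : ∀ {u v : V} (w : G.Walk u v), u ∈ c.supp → ∀ x y : G.Dart, x.fst = u → y.fst = v →
      s x = s y := by
    intro u v w
    induction w with
    | nil => exact fun hu x y hx hy => hvert x y (hx ▸ hu) (hx.trans hy.symm)
    | @cons a b z h p ih =>
      intro hu x y hx hy
      have hb : b ∈ c.supp := by
        rw [ConnectedComponent.mem_supp_iff] at hu ⊢
        rw [← hu]
        exact ConnectedComponent.sound h.symm.reachable
      let f : G.Dart := ⟨(a, b), h⟩
      calc s x = s f := hvert x f (hx ▸ hu) hx
        _ = s f.symm := (h2 f hu).symm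
        _ = s y := ih hb f.symm y rfl hy
  exact key w hd d e rfl rfl

section Homology

instance [Finite V] : Finite G.Dart :=
  Finite.of_injective _ Dart.toProd_injective

open Classical in
/-- The sum of `f ∘ g` over the darts of an edge. -/
noncomputable def edgeSum [Finite V] {X : Type*} (g : G.Dart → X) :
    (X → ZMod 2) →ₗ[ZMod 2] (Sym2 V → ZMod 2) :=
  letI := Fintype.ofFinite G.Dart
  { toFun := fun f e => ∑ d with d.edge = e, f (g d)
    map_add' := fun f f' => by ext e; simp [Finset.sum_add_distrib]
    map_smul' := fun a f => by ext e; simp [Finset.mul_sum] }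

open Classical in
theorem edgeSum_edge [Finite V] {X : Type*} (g : G.Dart → X) (f : X → ZMod 2) (d : G.Dart) :
    edgeSum g f d.edge = f (g d) + f (g d.symm) := by
  let _ := Fintype.ofFinite G.Dart
  have : (Finset.univ.filter fun e : G.Dart => e.edge = d.edge) = {d, d.symm} := by
    ext e
    simp [dart_edge_eq_iff]
  change ∑ e with e.edge = d.edge, f (g e) = _
  rw [this, Finset.sum_pair (Dart.symm_ne d).symm]

theorem edgeSum_of_notMem [Finite V] {X : Type*} (g : G.Dart → X) (f : X → ZMod 2) {e : Sym2 V}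
    (he : e ∉ G.edgeSet) : edgeSum g f e = 0 := by
  classical
  let _ := Fintype.ofFinite G.Dart
  change ∑ d with d.edge = e, f (g d) = _
  refine Finset.sum_eq_zero fun d hd => absurd ?_ he
  rw [← (Finset.mem_filter.1 hd).2]
  exact d.edge_mem

/-- Face boundaries are orthogonal to cuts, because a facial walk enters each vertex as often as it
leaves it. Reindexing by `faceStep` makes the contributions of heads and tails equal, and they
cancel modulo 2. -/
theorem sum_edgeSum_mul_edgeSum [Finite V] [Fintype (Sym2 V)] {X : Type*} (g : G.Dart → X)
    (hg : ∀ d, g (R.faceStep d) = g d) (f : X → ZMod 2) (t : V → ZMod 2) :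
    ∑ e, edgeSum g f e * edgeSum (fun d : G.Dart => d.fst) t e = 0 := by
  classical
  let _ := Fintype.ofFinite G.Dart
  have h1 : ∀ e, edgeSum g f e * edgeSum (fun d : G.Dart => d.fst) t e =
      ∑ d : G.Dart with d.edge = e, f (g d) * (t d.fst + t d.snd) := by
    intro e
    change (∑ d with d.edge = e, f (g d)) * _ = _
    rw [Finset.sum_mul]
    refine Finset.sum_congr rfl fun d hd => ?_
    rw [← (Finset.mem_filter.1 hd).2, edgeSum_edge]
    rfl
  simp_rw [h1]
  rw [Finset.sum_fiberwise]
  simp_rw [mul_add]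
  rw [Finset.sum_add_distrib]
  have h2 : ∑ d : G.Dart, f (g d) * t d.snd = ∑ d : G.Dart, f (g d) * t d.fst := by
    rw [← Equiv.sum_comp R.faceStep fun d => f (g d) * t d.fst]
    refine Finset.sum_congr rfl fun d _ => ?_
    rw [hg, fst_faceStep]
  rw [h2, CharTwo.add_self_eq_zero]

/-- The sum telescopes along the walk. For a closed walk it vanishes, so closed walks too are
orthogonal to cuts. -/
theorem sum_count_mul_edgeSum [Finite V] [DecidableEq V] (t : V → ZMod 2) (S : Finset (Sym2 V))
    {u v : V} (w : G.Walk u v) (hS : ∀ e ∈ w.edges, e ∈ S) :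
    ∑ e ∈ S, (w.edges.count e : ZMod 2) * edgeSum (fun d : G.Dart => d.fst) t e = t u + t v := by
  induction w with
  | nil => simp [CharTwo.add_self_eq_zero]
  | @cons a b z h p ih =>
    have hab : s(a, b) ∈ S := hS _ (by simp)
    have h1 : ∀ e, (((Walk.cons h p).edges.count e : ℕ) : ZMod 2) =
        (p.edges.count e : ZMod 2) + if e = s(a, b) then 1 else 0 := by
      intro e
      rw [Walk.edges_cons, List.count_cons]
      by_cases he : e = s(a, b)
      · simp [he]
      · simp [he, Ne.symm he]
    simp_rw [h1, add_mul]
    rw [Finset.sum_add_distrib, ih fun e he => hS e (by simp [he])]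
    simp only [ite_mul, one_mul, zero_mul]
    rw [Finset.sum_ite_eq' S, if_pos hab]
    have h2 := edgeSum_edge (fun d : G.Dart => d.fst) t ⟨(a, b), h⟩
    rw [Dart.edge_mk] at h2
    rw [h2]
    change t b + t z + (t a + t b) = _
    have := CharTwo.add_self_eq_zero (t b)
    linear_combination this

open Classical in
/-- In a planar component, every closed walk separates the faces into two classes. -/
theorem exists_separation [Finite V] {u : V} (w : G.Walk u u)
    (hE : R.EulerFormula (G.connectedComponentMk u)) :
    ∃ s : G.Dart → ZMod 2, (∀ d, s (R.faceStep d) = s d) ∧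
      ∀ d : G.Dart, s d + s d.symm = (w.edges.count d.edge : ZMod 2) := by
  set c := G.connectedComponentMk u with hc
  let F : Set (Set G.Dart) := R.facialWalk '' {d | d.fst ∈ c.supp}
  let E : Set (Sym2 V) := {e ∈ G.edgeSet | ∃ v ∈ e, v ∈ c.supp}
  let _ := Fintype.ofFinite V
  let _ := Fintype.ofFinite F
  let _ := Fintype.ofFinite E
  let _ := Fintype.ofFinite c.supp
  let _ := Fintype.ofFinite (Sym2 V)
  have hsnd : ∀ d : G.Dart, d.fst ∈ c.supp ↔ d.snd ∈ c.supp := by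
    intro d
    rw [ConnectedComponent.mem_supp_iff, ConnectedComponent.mem_supp_iff,
      ConnectedComponent.sound d.adj.reachable]
  have hdE : ∀ d : G.Dart, d.edge ∈ E ↔ d.fst ∈ c.supp := by
    intro d
    constructor
    · rintro ⟨-, v, hv, hvc⟩
      have : v = d.fst ∨ v = d.snd := Sym2.mem_iff.1 (show v ∈ s(d.fst, d.snd) from hv)
      rcases this with rfl | rfl
      · exact hvc
      · exact (hsnd d).2 hvc
    · exact fun h => ⟨d.edge_mem, d.fst, by simp [Dart.edge, Sym2.mem_iff], h⟩
  have hdF : ∀ d : G.Dart, R.facialWalk d ∈ F ↔ d.fst ∈ c.supp := by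
    intro d
    constructor
    · rintro ⟨e, he, hed⟩
      have h1 : d ∈ R.facialWalk e := hed ▸ R.mem_facialWalk_self d
      have h2 := R.reachable_of_mem_facialWalk h1
      have he' : e.fst ∈ c.supp := he
      rw [ConnectedComponent.mem_supp_iff] at he' ⊢
      rw [← he']
      exact ConnectedComponent.sound h2.symm
    · exact fun h => ⟨d, h, rfl⟩
  let δF : (F → ZMod 2) →ₗ[ZMod 2] (E → ZMod 2) :=
    LinearMap.funLeft (ZMod 2) (ZMod 2) (Subtype.val : E → Sym2 V) ∘ₗ
      edgeSum R.facialWalk ∘ₗ Function.ExtendByZero.linearMap (ZMod 2) Subtype.val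
  let δV : (c.supp → ZMod 2) →ₗ[ZMod 2] (E → ZMod 2) :=
    LinearMap.funLeft (ZMod 2) (ZMod 2) (Subtype.val : E → Sym2 V) ∘ₗ
      edgeSum (fun d : G.Dart => d.fst) ∘ₗ Function.ExtendByZero.linearMap (ZMod 2) Subtype.val
  have hδF : ∀ f e, δF f e = edgeSum R.facialWalk (Function.extend Subtype.val f 0) e.1 :=
    fun f e => rfl
  have hδV : ∀ t e, δV t e =
      edgeSum (fun d : G.Dart => d.fst) (Function.extend Subtype.val t 0) e.1 :=
    fun t e => rfl
  have hrF := card_le_finrank_range_add_one δF <| by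
    rintro f hf ⟨_, d, hd, rfl⟩ ⟨_, d', hd', rfl⟩
    have h1 := R.apply_eq_of_reachable (c := c)
      (s := fun d => Function.extend Subtype.val f 0 (R.facialWalk d)) (d := d) (e := d')
      (fun d _ => by simp only [facialWalk_faceStep]) (fun x hx => ?_) hd hd'
    · have key : ∀ x (hx : R.facialWalk x ∈ F), Function.extend Subtype.val f 0 (R.facialWalk x) =
          f ⟨_, hx⟩ :=
        fun x hx => Subtype.val_injective.extend_apply f 0 (⟨_, hx⟩ : F)
      simpa only [key _ ((hdF d).2 hd), key _ ((hdF d').2 hd')] using h1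
    · have := congrFun hf ⟨x.edge, (hdE x).2 hx⟩
      rw [hδF, edgeSum_edge] at this
      exact (CharTwo.add_eq_zero.1 this).symm
  have hrV := card_le_finrank_range_add_one δV <| by
    rintro t ht ⟨x, hx⟩ ⟨y, hy⟩
    have key : ∀ z (hz : z ∈ c.supp), Function.extend Subtype.val t 0 z = t ⟨z, hz⟩ :=
      fun z hz => Subtype.val_injective.extend_apply t 0 (⟨z, hz⟩ : c.supp)
    rw [← key x, ← key y]
    obtain ⟨p⟩ : G.Reachable x y :=
      ConnectedComponent.exact ((c.mem_supp_iff _).1 hx |>.trans ((c.mem_supp_iff _).1 hy).symm)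
    induction p with
    | nil => rfl
    | @cons a b z h p ih =>
      have hb := (hsnd ⟨(a, b), h⟩).1 hx
      rw [← ih hb hy]
      have := congrFun ht ⟨_, (hdE ⟨(a, b), h⟩).2 hx⟩
      rw [hδV, edgeSum_edge] at this
      exact CharTwo.add_eq_zero.1 this
  have hcard : Fintype.card c.supp + Fintype.card F = Fintype.card E + 2 := by
    simpa only [EulerFormula, ← Nat.card_coe_set_eq, Nat.card_eq_fintype_card] using hE
  have hext : ∀ (t : c.supp → ZMod 2) e, e ∉ E →
      edgeSum (fun d : G.Dart => d.fst) (Function.extend Subtype.val t 0) e = 0 := by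
    intro t e he
    by_cases he' : e ∈ G.edgeSet
    · induction e with | h a b => ?_
      let d : G.Dart := ⟨(a, b), he'⟩
      have hd : d.fst ∉ c.supp := fun h => he ((hdE d).2 h)
      have hd' : d.snd ∉ c.supp := fun h => hd ((hsnd d).2 h)
      change edgeSum _ _ d.edge = 0
      rw [edgeSum_edge, Function.extend_apply', Function.extend_apply']
      · simp
      · rintro ⟨z, hz⟩
        exact hd' (show d.symm.fst ∈ c.supp from hz ▸ z.2)
      · rintro ⟨z, hz⟩
        exact hd (hz ▸ z.2)
    · exact edgeSum_of_notMem _ _ he'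
  have hdot : ∀ (χ : Sym2 V → ZMod 2) (t : c.supp → ZMod 2),
      (fun e : E => χ e) ⬝ᵥ δV t =
        ∑ e, χ e * edgeSum (fun d : G.Dart => d.fst) (Function.extend Subtype.val t 0) e := by
    intro χ t
    rw [dotProduct]
    simp_rw [hδV]
    rw [← Finset.sum_subset (Finset.subset_univ (Finset.univ.filter (· ∈ E)))]
    · exact (Finset.sum_subtype (p := (· ∈ E)) (Finset.univ.filter (· ∈ E)) (by simp)
        fun e => χ e *
          edgeSum (fun d : G.Dart => d.fst) (Function.extend Subtype.val t 0) e).symm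
    · intro e _ he
      rw [hext t e (by simpa using he), mul_zero]
  -- The ranges of `δF` and `δV` have dimensions at least `|F| - 1` and `|V| - 1`, which by Euler's
  -- formula add up to `|E|`. So everything orthogonal to all cuts is a sum of face boundaries.
  have hw : (fun e : E => (w.edges.count e.1 : ZMod 2)) ∈ LinearMap.range δF := by
    refine mem_of_forall_dotProduct_eq_zero (C := LinearMap.range δV) ?_ (by omega) ?_
    · rintro _ ⟨f, rfl⟩ _ ⟨t, rfl⟩
      have h1 : δF f = fun e : E => edgeSum R.facialWalk (Function.extend Subtype.val f 0) e.1 :=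
        rfl
      rw [h1, hdot]
      exact R.sum_edgeSum_mul_edgeSum _ R.facialWalk_faceStep _ _
    · rintro _ ⟨t, rfl⟩
      rw [hdot (fun e => (w.edges.count e : ZMod 2))]
      rw [sum_count_mul_edgeSum _ Finset.univ w (by simp)]
      exact CharTwo.add_self_eq_zero _
  obtain ⟨f, hf⟩ := hw
  refine ⟨fun d => Function.extend Subtype.val f 0 (R.facialWalk d),
    fun d => by simp only [facialWalk_faceStep], fun d => ?_⟩
  by_cases hd : d.fst ∈ c.supp
  · have := congrFun hf ⟨d.edge, (hdE d).2 hd⟩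
    rwa [hδF, edgeSum_edge] at this
  · have h0 : ∀ x : G.Dart, x.fst ∉ c.supp →
        Function.extend (Subtype.val : F → _) f 0 (R.facialWalk x) = 0 := by
      intro x hx
      rw [Function.extend_apply']
      · rfl
      · rintro ⟨z, hz⟩
        exact hx ((hdF x).1 (hz ▸ z.2))
    beta_reduce
    rw [h0 d hd, h0 d.symm (fun h => hd ((hsnd d).2 h)), List.count_eq_zero_of_not_mem, add_zero,
      Nat.cast_zero]
    intro h
    have h1 : d.fst ∈ w.support :=
      w.fst_mem_support_of_mem_edges (show s(d.fst, d.snd) ∈ w.edges from h)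
    refine hd ?_
    rw [ConnectedComponent.mem_supp_iff, hc]
    exact ConnectedComponent.sound ⟨(w.takeUntil _ h1).reverse⟩

end Homology

end RotationSystem

theorem ZMod.eq_one_of_ne_zero_two {x : ZMod 2} (h : x ≠ 0) : x = 1 := by
  revert h
  revert x
  decide

/-! ### Multiplicities modulo 2 -/

section ListParity

variable {α : Type*}

open Classical in
/-- The multiplicity modulo 2 of `a` in the list `l`. -/
noncomputable def List.parity (l : List α) (a : α) : ZMod 2 :=
  l.count a

theorem List.parity_nil (a : α) : ([] : List α).parity a = 0 := by
  simp [List.parity]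

theorem List.parity_append (l l' : List α) (a : α) :
    (l ++ l').parity a = l.parity a + l'.parity a := by
  simp [List.parity]

theorem List.parity_cons (b : α) (l : List α) (a : α) :
    (b :: l).parity a = [b].parity a + l.parity a :=
  List.parity_append [b] l a

theorem List.parity_reverse (l : List α) (a : α) : l.reverse.parity a = l.parity a := by
  simp [List.parity]

theorem List.parity_of_notMem {l : List α} {a : α} (h : a ∉ l) : l.parity a = 0 := by
  classical
  rw [List.parity, List.count_eq_zero_of_not_mem h, Nat.cast_zero]

theorem List.parity_of_mem {l : List α} {a : α} (hl : l.Nodup) (h : a ∈ l) : l.parity a = 1 := by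
  classical
  rw [List.parity, List.count_eq_one_of_mem hl h, Nat.cast_one]

end ListParity

/-! ### Cycles and their chords -/

namespace SimpleGraph.Walk

variable {V : Type*} {G : SimpleGraph V}

theorem isCycle_cons_of_two_le {u v : V} {q : G.Walk u v} (hq : q.IsPath) (h : G.Adj v u)
    (hl : 2 ≤ q.length) : (cons h q).IsCycle := by
  refine (cons_isCycle_iff q h).2 ⟨hq, fun he => ?_⟩
  cases q with
  | nil => simp at hl
  | @cons _ x _ h1 p =>
    rw [cons_isPath_iff] at hq
    rw [edges_cons, List.mem_cons] at he
    rcases he with he | he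
    · have hx : x = v := by
        rcases Sym2.eq_iff.1 he with ⟨hvu, -⟩ | ⟨hvx, -⟩
        · exact absurd hvu h.ne
        · exact hvx.symm
      subst hx
      have := isPath_iff_nil.1 hq.1
      rw [← length_eq_zero_iff] at this
      simp [this] at hl
    · exact hq.2 (snd_mem_support_of_mem_edges _ he)

theorem isPath_of_isCycle_cons {u v : V} {q : G.Walk u v} {h : G.Adj v u}
    (hc : (cons h q).IsCycle) : q.IsPath :=
  ((cons_isCycle_iff q h).1 hc).1

theorem two_le_length_of_isCycle_cons {u v : V} {q : G.Walk u v} {h : G.Adj v u}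
    (hc : (cons h q).IsCycle) : 2 ≤ q.length := by
  have := hc.isCircuit.three_le_length
  rw [length_cons] at this
  omega

theorem support_cons_eq {u v : V} (q : G.Walk u v) (h : G.Adj v u) :
    {w | w ∈ (cons h q).support} = {w | w ∈ q.support} := by
  ext w
  simp only [support_cons, List.mem_cons, Set.mem_ofPred_eq, or_iff_right_iff_imp]
  rintro rfl
  exact q.end_mem_support

theorem two_le_length_of_edge_notMem {a b : V} (q : G.Walk a b) (hab : G.Adj a b)
    (h : s(a, b) ∉ q.edges) : 2 ≤ q.length := by
  cases q with
  | nil => exact absurd rfl hab.ne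
  | cons h1 p =>
    cases p with
    | nil => simp at h
    | cons h2 p => simp

/-- A chord of a cycle, seen from the path that is left when one edge of the cycle is removed. -/
theorem exists_append_of_isChord {u v : V} {q : G.Walk u v} {h : G.Adj v u}
    {e : Sym2 V} (he : (cons h q).IsChord e) :
    ∃ (a b : V) (q₁ : G.Walk u a) (q₂ : G.Walk a b) (q₃ : G.Walk b v),
      q = q₁.append (q₂.append q₃) ∧ G.Adj a b ∧ 2 ≤ q₂.length ∧ q₂.length < q.length := by
  classical
  induction e with | h x y => ?_
  obtain ⟨hxy, hne, hx, hy⟩ := isChord_sym2Mk.1 he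
  rw [edges_cons, List.mem_cons, not_or] at hne
  have hsupp : ∀ w ∈ (cons h q).support, w ∈ q.support := fun w =>
    (Set.ext_iff.1 (support_cons_eq q h) w).1
  replace hx := hsupp x hx
  replace hy := hsupp y hy
  have key : ∀ a b (q₁ : G.Walk u a) (q₂ : G.Walk a b) (q₃ : G.Walk b v),
      q = q₁.append (q₂.append q₃) → G.Adj a b → s(a, b) ∉ q.edges → s(a, b) ≠ s(v, u) →
      2 ≤ q₂.length ∧ q₂.length < q.length := by
    rintro a b q₁ q₂ q₃ rfl hab hab1 hab2
    constructor
    · exact q₂.two_le_length_of_edge_notMem hab fun h' => hab1 (by simp [h'])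
    · cases q₁ with
      | nil =>
        cases q₃ with
        | nil => exact absurd Sym2.eq_swap hab2
        | cons => simp
      | cons => simp; omega
  by_cases hy' : y ∈ (q.dropUntil x hx).support
  · refine ⟨x, y, q.takeUntil x hx, (q.dropUntil x hx).takeUntil y hy',
      (q.dropUntil x hx).dropUntil y hy', by rw [take_spec, take_spec], hxy,
      key _ _ _ _ _ (by rw [take_spec, take_spec]) hxy hne.2 hne.1⟩
  · have hy'' : y ∈ (q.takeUntil x hx).support := by
      rw [← take_spec q hx, mem_support_append_iff] at hy
      exact hy.resolve_right hy'
    have heq : q = ((q.takeUntil x hx).takeUntil y hy'').append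
        (((q.takeUntil x hx).dropUntil y hy'').append (q.dropUntil x hx)) := by
      rw [append_assoc, take_spec, take_spec]
    exact ⟨y, x, _, _, _, heq, hxy.symm, key _ _ _ _ _ heq hxy.symm (by rw [Sym2.eq_swap]; exact hne.2)
      (by rw [Sym2.eq_swap]; exact hne.1)⟩

theorem isPath_shortcut {u v a b : V} {q₁ : G.Walk u a} {q₂ : G.Walk a b} {q₃ : G.Walk b v}
    (hq : (q₁.append (q₂.append q₃)).IsPath) (hab : G.Adj a b) :
    (q₁.append (cons hab q₃)).IsPath := by
  rw [isPath_def] at hq ⊢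
  rw [support_append] at hq ⊢
  refine hq.sublist (List.Sublist.append (List.Sublist.refl _) ?_)
  rw [support_cons, List.tail_cons, support_append]
  have hb : b ∈ q₂.support.tail := end_mem_tail_support_of_ne hab.ne q₂
  rw [← cons_tail_support q₃, List.tail_append_of_ne_nil (by simp)]
  exact List.Sublist.append (List.singleton_sublist.2 hb) (List.Sublist.refl _)

theorem mem_support_inter_of_isPath {u v a b : V} {q₁ : G.Walk u a} {q₂ : G.Walk a b}
    {q₃ : G.Walk b v} (hq : (q₁.append (q₂.append q₃)).IsPath) {hab : G.Adj a b} {w : V}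
    (h1 : w ∈ (q₁.append (cons hab q₃)).support) (h2 : w ∈ q₂.support) : w = a ∨ w = b := by
  by_contra! hw
  have hq' := hq.of_append_right
  rw [isPath_def, support_append, List.nodup_append'] at hq hq'
  rw [support_append, List.mem_append, support_cons, List.tail_cons] at h1
  rcases h1 with h1 | h1
  · refine hq.2.2 h1 ?_
    rw [support_append, List.tail_append_of_ne_nil (by simp)]
    exact List.mem_append_left _ (((mem_support_iff _).1 h2).resolve_left hw.1)
  · exact hq'.2.2 h2 (((mem_support_iff _).1 h1).resolve_left hw.2)

end SimpleGraph.Walk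

/-! ### Faces enclosed by a closed walk -/

namespace OuterplaneEmbedding

open SimpleGraph

variable {V : Type*} {G : SimpleGraph V} (P : OuterplaneEmbedding G)

theorem faceStep_mem_outer_iff (d : G.Dart) : P.faceStep d ∈ P.outer ↔ d ∈ P.outer := by
  have hr : G.Reachable d.fst (P.faceStep d).fst := by
    rw [P.fst_faceStep]
    exact d.adj.reachable
  have hm : P.faceStep d ∈ P.facialWalk d := by
    rw [← P.facialWalk_faceStep]
    exact P.mem_facialWalk_self _
  constructor
  · intro h
    refine (P.mem_outer_iff _ _ hr.symm h).2 ?_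
    rw [P.facialWalk_faceStep]
    exact P.mem_facialWalk_self _
  · exact fun h => (P.mem_outer_iff _ _ hr h).2 hm

/-- The vertices on the boundary of the face to which the dart `d` belongs. -/
def faceSet (d : G.Dart) : Set V :=
  (fun e : G.Dart => e.fst) '' P.facialWalk d

theorem fst_mem_faceSet (d : G.Dart) : d.fst ∈ P.faceSet d :=
  ⟨d, P.mem_facialWalk_self d, rfl⟩

theorem faceSet_eq_of_mem {d e : G.Dart} (h : e ∈ P.facialWalk d) : P.faceSet e = P.faceSet d := by
  rw [faceSet, P.facialWalk_eq_of_mem h, faceSet]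

theorem faceSet_faceStep (d : G.Dart) : P.faceSet (P.faceStep d) = P.faceSet d := by
  rw [faceSet, P.facialWalk_faceStep, faceSet]

theorem snd_mem_faceSet (d : G.Dart) : d.snd ∈ P.faceSet d := by
  rw [← P.faceSet_faceStep, ← P.fst_faceStep]
  exact P.fst_mem_faceSet _

/-- `s` is the indicator function of a set of inner faces whose boundary consists of the edges that
occur an odd number of times in `L`. -/
structure Encloses (L : List (Sym2 V)) (s : G.Dart → ZMod 2) : Prop where
  faceStep : ∀ d, s (P.faceStep d) = s d
  outer : ∀ d ∈ P.outer, s d = 0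
  add_symm : ∀ d : G.Dart, s d + s d.symm = L.parity d.edge

variable {P}

namespace Encloses

variable {L L' : List (Sym2 V)} {s s' : G.Dart → ZMod 2}

theorem add (h : P.Encloses L s) (h' : P.Encloses L' s') :
    P.Encloses (L ++ L') (fun d => s d + s' d) where
  faceStep d := by rw [h.faceStep, h'.faceStep]
  outer d hd := by rw [h.outer d hd, h'.outer d hd, add_zero]
  add_symm d := by
    rw [List.parity_append, ← h.add_symm, ← h'.add_symm]
    ring

theorem congr (h : P.Encloses L s) (hL : ∀ e, L.parity e = L'.parity e) : P.Encloses L' s where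
  faceStep := h.faceStep
  outer := h.outer
  add_symm d := by rw [h.add_symm, hL]

/-- The difference takes the same value on both sides of every edge, so it is constant on each
component, and it vanishes on the outer face. -/
theorem unique (h : P.Encloses L s) (h' : P.Encloses L' s')
    (hL : ∀ d : G.Dart, L.parity d.edge = L'.parity d.edge) (d : G.Dart) : s d = s' d := by
  obtain ⟨o, ho, hod⟩ := P.exists_mem_outer d
  have key := P.apply_eq_of_reachable (c := G.connectedComponentMk d.fst)
    (s := fun d => s d - s' d) (d := d) (e := o)
    (fun x _ => by simp only [h.faceStep, h'.faceStep]) (fun x _ => ?_) rfl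
    (by rw [hod]; rfl)
  · simp only [h.outer o ho, h'.outer o ho] at key
    linear_combination key
  · have h1 := h.add_symm x
    rw [hL, ← h'.add_symm] at h1
    have h2 := CharTwo.add_self_eq_zero (s x)
    have h3 := CharTwo.add_self_eq_zero (s' x)
    linear_combination h1 - h2 + h3

/-- With no edge of `L` at the vertex, `s` is constant around it, and one of the darts there is
outer. Consequently an enclosed face has all its vertices on the enclosing walk. -/
theorem eq_zero_of_notMem (h : P.Encloses L s) {d : G.Dart} (hL : ∀ e ∈ L, d.fst ∉ e) :
    s d = 0 := by
  obtain ⟨o, ho, hod⟩ := P.exists_mem_outer d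
  rw [← h.outer o ho]
  refine ((Equiv.Perm.SameCycle.apply_eq (s := {z : G.Dart | z.fst = d.fst}) (f := s) ?_ ?_
      ?_ (P.sameCycle_next d o hod.symm) rfl).1).symm
  · intro z hz
    simpa [P.fst_next] using hz
  · intro z hz
    simpa [P.fst_next] using hz
  · intro z hz
    have h1 := h.faceStep z.symm
    rw [P.faceStep_apply, Dart.symm_symm] at h1
    have h2 := h.add_symm z
    rw [List.parity_of_notMem] at h2
    · rw [h1]
      exact (CharTwo.add_eq_zero.1 h2).symm
    · intro hzL
      refine hL _ hzL ?_
      rw [← (show z.fst = d.fst from hz)]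
      exact Sym2.mem_mk_left z.fst z.snd

theorem fst_mem_support {u : V} {w : G.Walk u u} (h : P.Encloses w.edges s) {d : G.Dart}
    (hd : s d ≠ 0) : d.fst ∈ w.support := by
  by_contra hw
  refine hd (h.eq_zero_of_notMem fun e he hde => hw ?_)
  exact w.mem_support_of_mem_edges he hde

theorem apply_eq_of_mem (h : P.Encloses L s) {d e : G.Dart} (he : e ∈ P.facialWalk d) :
    s e = s d :=
  P.apply_eq_of_mem_facialWalk h.faceStep he

theorem faceSet_subset {u : V} {w : G.Walk u u} (h : P.Encloses w.edges s) {d : G.Dart}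
    (hd : s d ≠ 0) : P.faceSet d ⊆ {x | x ∈ w.support} := by
  rintro _ ⟨e, he, rfl⟩
  exact h.fst_mem_support (by rwa [h.apply_eq_of_mem he])

theorem notMem_outer (h : P.Encloses L s) {d : G.Dart} (hd : s d ≠ 0) : d ∉ P.outer :=
  fun h' => hd (h.outer d h')

theorem symm_eq_zero (h : P.Encloses L s) {d : G.Dart} (hL : L.Nodup) (hd : d.edge ∈ L)
    (hs : s d ≠ 0) : s d.symm = 0 := by
  have h1 := h.add_symm d
  rw [List.parity_of_mem hL hd, ZMod.eq_one_of_ne_zero_two hs] at h1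
  linear_combination h1

theorem ne_zero_or_symm (h : P.Encloses L s) {d : G.Dart} (hL : L.Nodup) (hd : d.edge ∈ L) :
    s d ≠ 0 ∨ s d.symm ≠ 0 := by
  have h1 := h.add_symm d
  rw [List.parity_of_mem hL hd] at h1
  by_contra! h2
  rw [h2.1, h2.2] at h1
  simp at h1

/-- The boundary of an enclosed face does not turn back. -/
theorem faceStep_ne_symm (h : P.Encloses L s) {d : G.Dart} (hL : L.Nodup) (hd : d.edge ∈ L)
    (hs : s d ≠ 0) : P.faceStep d ≠ d.symm := by
  intro hds
  have := h.symm_eq_zero hL hd hs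
  rw [← hds, h.faceStep] at this
  exact hs this

end Encloses

variable (P)

theorem exists_encloses [Finite V] {u : V} (w : G.Walk u u) : ∃ s, P.Encloses w.edges s := by
  classical
  cases w with
  | nil => exact ⟨fun _ => 0, ⟨fun _ => rfl, fun _ _ => rfl, fun d => by simp [List.parity_nil]⟩⟩
  | @cons _ b _ h p =>
    obtain ⟨o, ho, hou⟩ := P.exists_mem_outer ⟨(u, b), h⟩
    obtain ⟨s, hs, hs'⟩ := P.exists_separation (Walk.cons h p) (P.planar ⟨(u, b), h⟩)
    have hadj : ∀ d : G.Dart, G.connectedComponentMk d.snd = G.connectedComponentMk d.fst :=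
      fun d => ConnectedComponent.sound d.adj.symm.reachable
    -- A separation is determined only up to a constant: subtracting its value on the outer face
    -- normalises it. Other components are not enclosed and get the value 0.
    refine ⟨fun d => if G.connectedComponentMk d.fst = G.connectedComponentMk u then s d - s o
      else 0, ?_, ?_, ?_⟩
    · intro d
      simp only [P.fst_faceStep, hadj, hs]
    · intro d hd
      split_ifs with hdu
      · have hr : G.Reachable o.fst d.fst := by
          rw [hou]
          exact ConnectedComponent.exact hdu.symm
        rw [P.apply_eq_of_mem_facialWalk hs ((P.mem_outer_iff o d hr ho).1 hd), sub_self]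
      · rfl
    · intro d
      have hsymm : d.symm.fst = d.snd := rfl
      simp only [hsymm, hadj]
      split_ifs with hdu
      · have h1 := hs' d
        have h2 := CharTwo.add_self_eq_zero (s o)
        have h3 : (Walk.cons h p).edges.parity d.edge =
            ((Walk.cons h p).edges.count d.edge : ZMod 2) := by
          rw [List.parity]
          congr!
        rw [h3]
        convert (show s d - s o + (s d.symm - s o) = s d + s d.symm by
          linear_combination -h2).trans h1
      · rw [List.parity_of_notMem, add_zero]
        intro hd
        have h1 : d.fst ∈ (Walk.cons h p).support :=
          Walk.fst_mem_support_of_mem_edges _ (show s(d.fst, d.snd) ∈ _ from hd)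
        exact hdu (ConnectedComponent.sound ⟨((Walk.cons h p).takeUntil _ h1).reverse⟩)

variable {P}

/-- Splitting a cycle along a chord. -/
theorem Encloses.exists_split [Finite V] {u v a b : V} {q₁ : G.Walk u a} {q₂ : G.Walk a b}
    {q₃ : G.Walk b v} {h : G.Adj v u} {s : G.Dart → ZMod 2}
    (hs : P.Encloses (Walk.cons h (q₁.append (q₂.append q₃))).edges s) (hab : G.Adj a b) :
    ∃ s₁ s₂, P.Encloses (Walk.cons h (q₁.append (Walk.cons hab q₃))).edges s₁ ∧
      P.Encloses (Walk.cons hab.symm q₂).edges s₂ ∧ ∀ d, s d = s₁ d + s₂ d := by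
  obtain ⟨s₁, h₁⟩ := P.exists_encloses (Walk.cons h (q₁.append (Walk.cons hab q₃)))
  obtain ⟨s₂, h₂⟩ := P.exists_encloses (Walk.cons hab.symm q₂)
  refine ⟨s₁, s₂, h₁, h₂, fun d => ?_⟩
  refine hs.unique (h₁.add h₂) (fun d => ?_) d
  simp only [Walk.edges_cons, Walk.edges_append, List.parity_append]
  rw [List.parity_cons s(v, u) (q₁.edges ++ (q₂.edges ++ q₃.edges)),
    List.parity_cons s(v, u) (q₁.edges ++ s(a, b) :: q₃.edges), List.parity_append q₁.edges (_ :: _),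
    List.parity_cons s(a, b) q₃.edges, List.parity_cons s(b, a) q₂.edges,
    Sym2.eq_swap (a := b) (b := a)]
  simp only [List.parity_append]
  -- The chord lies on both smaller cycles and cancels modulo 2.
  have := CharTwo.add_self_eq_zero ([s(a, b)].parity d.edge)
  linear_combination -this

/-- The cycle around a single face. -/
theorem Encloses.faceSet_eq_of_isChordless {u v : V} {q : G.Walk u v} {h : G.Adj v u}
    {s : G.Dart → ZMod 2} (hs : P.Encloses (Walk.cons h q).edges s)
    (hc : (Walk.cons h q).IsCycle) (hch : (Walk.cons h q).IsChordless) {d : G.Dart}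
    (hd : s d ≠ 0) : P.faceSet d = {x | x ∈ q.support} := by
  have hsub : P.faceSet d ⊆ {x | x ∈ q.support} := by
    rw [← Walk.support_cons_eq q h]
    exact hs.faceSet_subset hd
  have hL : (Walk.cons h q).edges.Nodup := hc.isCircuit.isTrail.edges_nodup
  have hedge : ∀ e ∈ P.facialWalk d, e.edge ∈ (Walk.cons h q).edges := by
    intro e he
    have hse : s e ≠ 0 := by rwa [hs.apply_eq_of_mem he]
    exact hch.mem_edges (hs.faceSet_subset hse (P.fst_mem_faceSet e))
      (hs.faceSet_subset hse (P.snd_mem_faceSet e)) e.adj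
  -- An enclosed face runs along edges of the cycle and does not turn back, so at each of its
  -- vertices it uses two different cycle edges. A neighbour on the cycle that it missed would be a
  -- third.
  have hclosed : ∀ x ∈ P.faceSet d, ∀ y, s(x, y) ∈ (Walk.cons h q).edges → y ∈ P.faceSet d := by
    rintro _ ⟨e, he, rfl⟩ y hy
    by_contra hyF
    have hse : s e ≠ 0 := by rwa [hs.apply_eq_of_mem he]
    obtain ⟨f, rfl⟩ := P.faceStep.surjective e
    rw [hs.faceStep] at hse
    have hf : f ∈ P.facialWalk d := by
      have h1 : f ∈ P.facialWalk (P.faceStep f) := by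
        rw [P.facialWalk_faceStep]
        exact P.mem_facialWalk_self _
      rwa [P.facialWalk_eq_of_mem he] at h1
    have hne := hs.faceStep_ne_symm hL (hedge f hf) hse
    have h2 := hc.ncard_neighborSet_toSubgraph_eq_two
      (Walk.fst_mem_support_of_mem_edges _ hy)
    have hy' : y ∈ (Walk.cons h q).toSubgraph.neighborSet (P.faceStep f).fst :=
      Walk.adj_toSubgraph_iff_mem_edges.2 hy
    have ha : f.fst ∈ (Walk.cons h q).toSubgraph.neighborSet (P.faceStep f).fst := by
      refine Walk.adj_toSubgraph_iff_mem_edges (p := Walk.cons h q).2 ?_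
      rw [P.fst_faceStep, Sym2.eq_swap]
      exact hedge f hf
    have hb : (P.faceStep f).snd ∈ (Walk.cons h q).toSubgraph.neighborSet (P.faceStep f).fst :=
      Walk.adj_toSubgraph_iff_mem_edges.2 (hedge _ he)
    have hya : y ≠ f.fst := by
      rintro rfl
      exact hyF (P.faceSet_eq_of_mem hf ▸ P.fst_mem_faceSet f)
    have hyb : y ≠ (P.faceStep f).snd := by
      rintro rfl
      exact hyF (P.faceSet_eq_of_mem he ▸ P.snd_mem_faceSet _)
    have hab : f.fst ≠ (P.faceStep f).snd := by
      intro hab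
      refine hne (Dart.ext _ _ (Prod.ext ?_ hab.symm))
      exact P.fst_faceStep f
    have h3 : ({y, f.fst, (P.faceStep f).snd} : Set V).ncard ≤ 2 := by
      rw [← h2]
      refine Set.ncard_le_ncard ?_ (Set.finite_of_ncard_ne_zero (by omega))
      rintro z (rfl | rfl | rfl) <;> assumption
    rw [Set.ncard_eq_three.2 ⟨_, _, _, hya, hyb, hab, rfl⟩] at h3
    omega
  refine hsub.antisymm fun x hx => ?_
  have hreach : ∀ {a b : V} (p : G.Walk a b), (∀ e ∈ p.edges, e ∈ (Walk.cons h q).edges) →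
      (a ∈ P.faceSet d ↔ b ∈ P.faceSet d) := by
    intro a b p
    induction p with
    | nil => simp
    | @cons a b z hab p ih =>
      intro hp
      rw [← ih fun e he => hp e (by simp [he])]
      have hmem : s(a, b) ∈ (Walk.cons h q).edges := hp _ (by simp)
      exact ⟨fun h' => hclosed a h' b hmem, fun h' => hclosed b h' a (by rwa [Sym2.eq_swap])⟩
  classical
  have hu : ∀ y ∈ q.support, (u ∈ P.faceSet d ↔ y ∈ P.faceSet d) := fun y hy =>
    hreach (q.takeUntil y hy) fun e he => by
      simp [q.edges_takeUntil_subset_edges hy he]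
  exact (hu x hx).1 ((hu d.fst (hsub (P.fst_mem_faceSet d))).2 (P.fst_mem_faceSet d))

end OuterplaneEmbedding

/-! ### Connectedness after deleting a vertex -/

namespace SimpleGraph

variable {V : Type*} {G : SimpleGraph V}

/-- Deleting a vertex with at most one neighbour does not disconnect. -/
theorem Connected.induce_diff_singleton {S : Set V} {x y : V} (hS : (G.induce S).Connected)
    (hy : y ∈ S) (hyx : y ≠ x) (hx : ∀ z ∈ S, G.Adj x z → z = y) :
    (G.induce (S \ {x})).Connected := by
  have key : ∀ {a b : S} (w : (G.induce S).Walk a b) (ha : a.1 ≠ x), b = ⟨y, hy⟩ →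
      (G.induce (S \ {x})).Reachable ⟨a, a.2, ha⟩ ⟨y, hy, hyx⟩ := by
    intro a b w
    induction w with
    | nil =>
      rintro ha rfl
      rfl
    | @cons a b c hab p ih =>
      intro ha hc
      by_cases hb : b.1 = x
      · have hay : a.1 = y := hx a a.2 (hb ▸ hab.symm)
        have : (⟨a, a.2, ha⟩ : ↥(S \ {x})) = ⟨y, hy, hyx⟩ := Subtype.ext hay
        rw [this]
      · refine Reachable.trans (Adj.reachable ?_) (ih hb hc)
        exact hab
  rw [connected_iff_exists_forall_reachable]
  refine ⟨⟨y, hy, hyx⟩, fun ⟨a, ha, hax⟩ => ?_⟩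
  obtain ⟨w⟩ := hS.preconnected ⟨a, ha⟩ ⟨y, hy⟩
  exact (key w hax rfl).symm

namespace Walk

theorem support_cons_diff_singleton {u x v : V} {h : G.Adj u x} {p : G.Walk x v}
    (hp : (cons h p).IsPath) :
    {w | w ∈ (cons h p).support} \ {u} = {w | w ∈ p.support} := by
  rw [cons_isPath_iff] at hp
  ext w
  simp only [support_cons, List.mem_cons, Set.mem_sdiff, Set.mem_ofPred_eq, Set.mem_singleton_iff]
  constructor
  · rintro ⟨rfl | hw, hne⟩
    · exact absurd rfl hne
    · exact hw
  · intro hw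
    refine ⟨Or.inr hw, ?_⟩
    rintro rfl
    exact hp.2 hw

/-- Deleting a suitable vertex from a cycle leaves a path. -/
theorem exists_connected_support_diff_singleton {u v : V} {q : G.Walk u v} (h : G.Adj v u)
    (hq : q.IsPath) (hl : 2 ≤ q.length) {β : Set V} (hβ : ¬(u ∈ β ∧ v ∈ β)) :
    ∃ w ∈ q.support, (u = w ↔ u ∈ β) ∧ (v = w ↔ v ∈ β) ∧
      (G.induce ({x | x ∈ q.support} \ {w})).Connected := by
  by_cases hv : v ∈ β
  · have hu : u ∉ β := fun hu => hβ ⟨hu, hv⟩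
    refine ⟨v, q.end_mem_support, by simp [hu, h.ne'], by simp [hv], ?_⟩
    have hr : {x | x ∈ q.support} = {x | x ∈ q.reverse.support} := by
      simp
    have hq' := hq.reverse
    rw [hr]
    generalize q.reverse = r at hq'
    cases r with
    | nil => exact absurd rfl h.ne
    | cons h' p =>
      rw [support_cons_diff_singleton hq']
      exact p.connected_induce_support
  · cases q with
    | nil => simp at hl
    | @cons _ x _ h1 q =>
      cases q with
      | nil => simp at hl
      | @cons _ y _ h2 p =>
        have hpath := hq
        rw [cons_isPath_iff] at hq
        by_cases hu : u ∈ β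
        · refine ⟨u, by simp, by simp [hu], by simp [hv, h.ne], ?_⟩
          rw [support_cons_diff_singleton hpath]
          exact connected_induce_support _
        -- Here neither end may be deleted. The second vertex `x` is taken, and the rest of the
        -- cycle is a path through the edge `vu`.
        · have hxv : v ≠ x := by
            rintro rfl
            exact ((cons_isPath_iff _ _).1 hq.1).2 p.end_mem_support
          refine ⟨x, by simp, by simp [hu, h1.ne], by simp [hv, hxv], ?_⟩
          have : {w | w ∈ (cons h1 (cons h2 p)).support} \ {x} =
              {w | w ∈ (p.concat h).support} := by
            ext w
            have hxp := ((cons_isPath_iff _ _).1 hq.1).2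
            simp only [support_cons, List.mem_cons, Set.mem_sdiff, Set.mem_ofPred_eq,
              Set.mem_singleton_iff, support_concat, List.mem_append, List.not_mem_nil,
              or_false]
            constructor
            · rintro ⟨rfl | rfl | hw, hne⟩
              · exact Or.inr rfl
              · exact absurd rfl hne
              · exact Or.inl hw
            · rintro (hw | rfl)
              · refine ⟨Or.inr (Or.inr hw), ?_⟩
                rintro rfl
                exact hxp hw
              · exact ⟨Or.inl rfl, h1.ne⟩
          rw [this]
          exact connected_induce_support _

/-- The last vertex of a walk with a given property. -/
theorem exists_append_last {a b : V} (p : G.Walk a b) {Q : V → Prop} (h : ∃ y ∈ p.support, Q y) :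
    ∃ (w : V) (p₁ : G.Walk a w) (p₂ : G.Walk w b), p = p₁.append p₂ ∧ Q w ∧
      ∀ y ∈ p₂.support, Q y → y = w := by
  induction p with
  | @nil a =>
    obtain ⟨y, hy, hQ⟩ := h
    rw [support_nil, List.mem_singleton] at hy
    subst hy
    exact ⟨y, nil, nil, rfl, hQ, by simp⟩
  | @cons a c b hac p ih =>
    by_cases h' : ∃ y ∈ p.support, Q y
    · obtain ⟨w, p₁, p₂, rfl, hw, hlast⟩ := ih h'
      exact ⟨w, cons hac p₁, p₂, rfl, hw, hlast⟩
    · push Not at h'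
      obtain ⟨y, hy, hQ⟩ := h
      rw [support_cons, List.mem_cons] at hy
      obtain rfl | hy := hy
      · refine ⟨y, nil, cons hac p, rfl, hQ, fun z hz hQz => ?_⟩
        rw [support_cons, List.mem_cons] at hz
        exact hz.resolve_right fun hz => h' z hz hQz
      · exact absurd hQ (h' y hy)

end Walk

end SimpleGraph

/-! ### Vertex sets that cut the faces inside one cycle -/

namespace OuterplaneEmbedding

open SimpleGraph

variable {V : Type*} {G : SimpleGraph V} (P : OuterplaneEmbedding G)

/-- The face of `d` meets `B`, and what is left of it without `B` is connected. -/
def FaceCut (B : Set V) (d : G.Dart) : Prop :=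
  (P.faceSet d ∩ B).Nonempty ∧ (G.induce (P.faceSet d \ B)).Connected

/-- The face of `d` meets `B` in a single vertex, and what is left of it is connected. -/
def FaceCutOnce (B : Set V) (d : G.Dart) : Prop :=
  ∃ w, P.faceSet d ∩ B = {w} ∧ (G.induce (P.faceSet d \ {w})).Connected

variable {P}

theorem FaceCutOnce.faceCut {B : Set V} {d : G.Dart} (h : P.FaceCutOnce B d) : P.FaceCut B d := by
  obtain ⟨w, hw, hc⟩ := h
  refine ⟨hw ▸ Set.singleton_nonempty w, ?_⟩
  rwa [← Set.sdiff_self_inter, hw]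

theorem FaceCutOnce.congr {B B' : Set V} {d : G.Dart} (h : P.FaceCutOnce B d)
    (hB : P.faceSet d ∩ B' = P.faceSet d ∩ B) : P.FaceCutOnce B' d := by
  rwa [FaceCutOnce, hB]

theorem FaceCut.congr {B B' : Set V} {d : G.Dart} (h : P.FaceCut B d)
    (hB : P.faceSet d ∩ B' = P.faceSet d ∩ B) : P.FaceCut B' d := by
  rw [FaceCut, hB, ← Set.sdiff_self_inter, hB, Set.sdiff_self_inter]
  exact h

/-- The gluing principle: sets chosen on two pieces do not disturb each other if they agree on the
overlap. -/
theorem mem_union_iff_of_agree {S₁ S₂ B₁ B₂ : Set V} (h₂ : B₂ ⊆ S₂)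
    (h : ∀ w ∈ S₁, w ∈ S₂ → (w ∈ B₁ ↔ w ∈ B₂)) {w : V} (hw : w ∈ S₁) :
    w ∈ B₁ ∪ B₂ ↔ w ∈ B₁ := by
  constructor
  · rintro (h' | h')
    · exact h'
    · exact (h w hw (h₂ h')).2 h'
  · exact Or.inl

theorem inter_union_eq_of_agree {S₁ S₂ B₁ B₂ F : Set V} (h₂ : B₂ ⊆ S₂)
    (h : ∀ w ∈ S₁, w ∈ S₂ → (w ∈ B₁ ↔ w ∈ B₂)) (hF : F ⊆ S₁) : F ∩ (B₁ ∪ B₂) = F ∩ B₁ := by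
  ext w
  simp only [Set.mem_inter_iff, and_congr_right_iff]
  exact fun hw => mem_union_iff_of_agree h₂ h (hF hw)

/-- Induction over chords. `β` matters only at `u` and `v`. If there is no chord, every enclosed
face has the whole cycle as its vertex set, and one vertex suffices. Otherwise the set found on the
side of `vu` prescribes the choice at the ends of the chord for the other side. This is admissible
because the chord lies on an enclosed face and so does not have both ends in that set. -/
theorem Encloses.exists_faceCutOnce [Finite V] (n : ℕ) :
    ∀ {u v : V} {q : G.Walk u v} {h : G.Adj v u} {s : G.Dart → ZMod 2}, q.length = n →
      P.Encloses (Walk.cons h q).edges s → (Walk.cons h q).IsCycle →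
      ∀ {β : Set V}, ¬(u ∈ β ∧ v ∈ β) →
      ∃ B ⊆ {w | w ∈ q.support}, (u ∈ B ↔ u ∈ β) ∧ (v ∈ B ↔ v ∈ β) ∧
        ∀ d, s d ≠ 0 → ¬(d.fst ∈ B ∧ d.snd ∈ B) ∧ P.FaceCutOnce B d := by
  induction n using Nat.strong_induction_on with
  | _ n ih =>
  intro u v q h s hn hs hc β hβ
  have hq := Walk.isPath_of_isCycle_cons hc
  by_cases hch : (Walk.cons h q).IsChordless
  · obtain ⟨w, hw, hwu, hwv, hconn⟩ := Walk.exists_connected_support_diff_singleton h hq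
      (Walk.two_le_length_of_isCycle_cons hc) hβ
    refine ⟨{w}, by simpa using hw, hwu, hwv, fun d hd => ⟨?_, w, ?_, ?_⟩⟩
    · rintro ⟨h1, h2⟩
      rw [Set.mem_singleton_iff] at h1 h2
      exact d.fst_ne_snd (h1.trans h2.symm)
    · rw [hs.faceSet_eq_of_isChordless hc hch hd]
      simpa using hw
    · rwa [hs.faceSet_eq_of_isChordless hc hch hd]
  · rw [Walk.IsChordless] at hch
    push Not at hch
    obtain ⟨e, he⟩ := hch
    obtain ⟨a, b, q₁, q₂, q₃, rfl, hab, hl, hl'⟩ := Walk.exists_append_of_isChord he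
    obtain ⟨s₁, s₂, h₁, h₂, hss⟩ := hs.exists_split hab
    simp only [Walk.length_append] at hl' hn
    have hc₁ : (Walk.cons h (q₁.append (Walk.cons hab q₃))).IsCycle :=
      Walk.isCycle_cons_of_two_le (Walk.isPath_shortcut hq hab) h (by simp; omega)
    have hc₂ : (Walk.cons hab.symm q₂).IsCycle :=
      Walk.isCycle_cons_of_two_le hq.of_append_right.of_append_left hab.symm hl
    obtain ⟨B₁, hB₁, hu₁, hv₁, hd₁⟩ := ih _ (by simp; omega) rfl h₁ hc₁ hβ
    have hab' : ¬(a ∈ B₁ ∧ b ∈ B₁) := by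
      rcases h₁.ne_zero_or_symm (d := ⟨(a, b), hab⟩) hc₁.isCircuit.isTrail.edges_nodup
        (by simp) with hd | hd
      · exact (hd₁ _ hd).1
      · exact fun hab' => (hd₁ _ hd).1 hab'.symm
    obtain ⟨B₂, hB₂, ha₂, hb₂, hd₂⟩ := ih _ (by omega) rfl h₂ hc₂ hab'
    have hagree : ∀ w ∈ {w | w ∈ (q₁.append (Walk.cons hab q₃)).support},
        w ∈ {w | w ∈ q₂.support} → (w ∈ B₁ ↔ w ∈ B₂) := by
      intro w hw hw'
      rcases Walk.mem_support_inter_of_isPath hq hw hw' with rfl | rfl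
      · exact ha₂.symm
      · exact hb₂.symm
    have hmem₁ : ∀ {w}, w ∈ (q₁.append (Walk.cons hab q₃)).support →
        (w ∈ B₁ ∪ B₂ ↔ w ∈ B₁) := fun hw => mem_union_iff_of_agree hB₂ hagree hw
    have hmem₂ : ∀ {w}, w ∈ q₂.support → (w ∈ B₁ ∪ B₂ ↔ w ∈ B₂) := fun hw => by
      rw [Set.union_comm]
      exact mem_union_iff_of_agree hB₁ (fun w h h' => (hagree w h' h).symm) hw
    refine ⟨B₁ ∪ B₂, ?_, (hmem₁ (Walk.start_mem_support _)).trans hu₁,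
      (hmem₁ (Walk.end_mem_support _)).trans hv₁, fun d hd => ?_⟩
    · rintro w (hw | hw)
      · have := hB₁ hw
        simp only [Set.mem_ofPred_eq, Walk.mem_support_append_iff, Walk.support_cons,
          List.mem_cons] at this ⊢
        rcases this with this | rfl | this
        · exact Or.inl this
        · exact Or.inl (Walk.end_mem_support _)
        · exact Or.inr (Or.inr this)
      · have : w ∈ q₂.support := hB₂ hw
        simp [this]
    · by_cases hd1 : s₁ d = 0
      · have hd2 : s₂ d ≠ 0 := by
          rw [hss, hd1, zero_add] at hd
          exact hd
        have hF := Walk.support_cons_eq q₂ hab.symm ▸ h₂.faceSet_subset hd2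
        rw [hmem₂ (hF (P.fst_mem_faceSet d)), hmem₂ (hF (P.snd_mem_faceSet d))]
        refine ⟨(hd₂ d hd2).1, (hd₂ d hd2).2.congr ?_⟩
        rw [Set.union_comm]
        exact inter_union_eq_of_agree hB₁ (fun w h h' => (hagree w h' h).symm) hF
      · have hF := Walk.support_cons_eq _ h ▸ h₁.faceSet_subset hd1
        rw [hmem₁ (hF (P.fst_mem_faceSet d)), hmem₁ (hF (P.snd_mem_faceSet d))]
        exact ⟨(hd₁ d hd1).1, (hd₁ d hd1).2.congr (inter_union_eq_of_agree hB₂ hagree hF)⟩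

/-- A vertex of a cycle without chords, next to a vertex of `B`, can be added to `B`. -/
theorem Encloses.faceCut_insert {u x y v : V} {h₁ : G.Adj u x} {h₂ : G.Adj x y}
    {p : G.Walk y v} {h : G.Adj v u} {s : G.Dart → ZMod 2}
    (hs : P.Encloses (Walk.cons h (Walk.cons h₁ (Walk.cons h₂ p))).edges s)
    (hc : (Walk.cons h (Walk.cons h₁ (Walk.cons h₂ p))).IsCycle)
    (hx : ∀ z ∈ p.support, G.Adj x z → z = y) {B : Set V} (hu : u ∈ B)
    (hB : ∀ d, s d ≠ 0 → ¬(d.fst ∈ B ∧ d.snd ∈ B) ∧ P.FaceCutOnce B d) :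
    x ∉ B ∧ y ∉ B ∧ (∀ d, s d ≠ 0 → P.FaceCut (insert x B) d) ∧
      ∀ d, s d ≠ 0 → s d.symm ≠ 0 → ¬(d.fst ∈ insert x B ∧ d.snd ∈ insert x B) := by
  have hL := hc.isCircuit.isTrail.edges_nodup
  have hq := Walk.isPath_of_isCycle_cons hc
  have huy : u ≠ y := by
    rintro rfl
    refine ((Walk.cons_isPath_iff _ _).1 hq).2 ?_
    simp
  have hux : s(u, x) ∈ (Walk.cons h (Walk.cons h₁ (Walk.cons h₂ p))).edges := by simp
  have hxy : s(x, y) ∈ (Walk.cons h (Walk.cons h₁ (Walk.cons h₂ p))).edges := by simp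
  have hxB : x ∉ B := by
    rcases hs.ne_zero_or_symm (d := ⟨(u, x), h₁⟩) hL hux with hd | hd
    · exact fun hxB => (hB _ hd).1 ⟨hu, hxB⟩
    · exact fun hxB => (hB _ hd).1 ⟨hxB, hu⟩
  have hsupp : ∀ {d}, s d ≠ 0 → ∀ z ∈ P.faceSet d, G.Adj x z → z = u ∨ z = y := by
    intro d hd z hz hxz
    have := hs.faceSet_subset hd hz
    simp only [Walk.support_cons, List.mem_cons, Set.mem_ofPred_eq] at this
    rcases this with rfl | rfl | rfl | this
    · exact Or.inr (hx _ p.end_mem_support hxz)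
    · exact Or.inl rfl
    · exact absurd rfl hxz.ne
    · exact Or.inr (hx _ this hxz)
  have hedge : ∀ z, z = u ∨ z = y →
      s(x, z) ∈ (Walk.cons h (Walk.cons h₁ (Walk.cons h₂ p))).edges := by
    rintro z (rfl | rfl)
    · rwa [Sym2.eq_swap]
    · exact hxy
  -- An enclosed face through `x` must pass between `u` and `y`, its only possible neighbours. So
  -- `u` is the one vertex of `B` on this face.
  have hface : ∀ d, s d ≠ 0 → x ∈ P.faceSet d →
      y ∈ P.faceSet d ∧ P.faceSet d ∩ B = {u} ∧
        (G.induce (P.faceSet d \ {u})).Connected := by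
    rintro d hd ⟨e, he, hex⟩
    change e.fst = x at hex
    obtain ⟨f, rfl⟩ := P.faceStep.surjective e
    have hf : f ∈ P.facialWalk d := by
      have h1 : f ∈ P.facialWalk (P.faceStep f) := by
        rw [P.facialWalk_faceStep]
        exact P.mem_facialWalk_self _
      rwa [P.facialWalk_eq_of_mem he] at h1
    have hfx : f.snd = x := (P.fst_faceStep f).symm.trans hex
    have hsf : s f ≠ 0 := by rwa [hs.apply_eq_of_mem hf]
    have hfF : f.fst ∈ P.faceSet d := P.faceSet_eq_of_mem hf ▸ P.fst_mem_faceSet f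
    have heF : (P.faceStep f).snd ∈ P.faceSet d :=
      P.faceSet_eq_of_mem he ▸ P.snd_mem_faceSet _
    have h1 := hsupp hd _ hfF (hfx ▸ f.adj.symm)
    have h2 := hsupp hd _ heF (hex ▸ (P.faceStep f).adj)
    have hfe : f.edge ∈ (Walk.cons h (Walk.cons h₁ (Walk.cons h₂ p))).edges := by
      have hfe : f.edge = s(x, f.fst) := by
        rw [← hfx, Sym2.eq_swap]
        rfl
      rw [hfe]
      exact hedge _ h1
    have hne : f.fst ≠ (P.faceStep f).snd := by
      intro hne
      refine hs.faceStep_ne_symm hL hfe hsf (Dart.ext _ _ (Prod.ext ?_ hne.symm))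
      exact P.fst_faceStep f
    have huF : u ∈ P.faceSet d ∧ y ∈ P.faceSet d := by
      rcases h1 with h1 | h1 <;> rcases h2 with h2 | h2
      · exact absurd (h1.trans h2.symm) hne
      · exact ⟨h1 ▸ hfF, h2 ▸ heF⟩
      · exact ⟨h2 ▸ heF, h1 ▸ hfF⟩
      · exact absurd (h1.trans h2.symm) hne
    obtain ⟨w, hw, hconn⟩ := (hB d hd).2
    have huw : u = w := by
      have : u ∈ P.faceSet d ∩ B := ⟨huF.1, hu⟩
      rwa [hw] at this
    subst huw
    exact ⟨huF.2, hw, hconn⟩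
  have hyB : y ∉ B := by
    have key : ∀ d, s d ≠ 0 → x ∈ P.faceSet d → y ∉ B := by
      intro d hd hxd hyB
      obtain ⟨hyF, hFB, -⟩ := hface d hd hxd
      have : y ∈ P.faceSet d ∩ B := ⟨hyF, hyB⟩
      rw [hFB] at this
      exact huy this.symm
    rcases hs.ne_zero_or_symm (d := ⟨(u, x), h₁⟩) hL hux with hd | hd
    · exact key _ hd (P.snd_mem_faceSet _)
    · exact key _ hd (P.fst_mem_faceSet _)
  refine ⟨hxB, hyB, fun d hd => ?_, fun d hd hd' => ?_⟩
  · by_cases hxF : x ∈ P.faceSet d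
    · obtain ⟨hyF, hFB, hconn⟩ := hface d hd hxF
      refine ⟨⟨x, hxF, Set.mem_insert _ _⟩, ?_⟩
      have hset : P.faceSet d \ insert x B = (P.faceSet d \ {u}) \ {x} := by
        rw [← hFB, Set.sdiff_self_inter, Set.sdiff_sdiff, Set.union_comm, Set.singleton_union]
      rw [hset]
      -- Once `u` is gone, `x` has only the neighbour `y` on this face.
      refine hconn.induce_diff_singleton (y := y) ⟨hyF, huy.symm⟩ h₂.ne' fun z hz hxz => ?_
      exact (hsupp hd z hz.1 hxz).resolve_left hz.2
    · refine (hB d hd).2.faceCut.congr ?_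
      ext z
      simp only [Set.mem_inter_iff, Set.mem_insert_iff, and_congr_right_iff, or_iff_right_iff_imp]
      rintro hz rfl
      exact absurd hz hxF
  -- An edge with enclosed faces on both sides cannot end in `x`, where all relevant edges belong to
  -- the cycle and are enclosed on one side only.
  · have key : ∀ d, s d ≠ 0 → s d.symm ≠ 0 → d.fst ≠ x := by
      rintro d hd hd' rfl
      exact hd' (hs.symm_eq_zero hL (hedge _ (hsupp hd _ (P.snd_mem_faceSet d) d.adj)) hd)
    rintro ⟨h1, h2⟩
    exact (hB d hd).1 ⟨h1.resolve_left (key d hd hd'),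
      h2.resolve_left (key d.symm hd' (by rwa [Dart.symm_symm]))⟩

/-- A face may now contain several vertices of `B`, and adjacent vertices of `B` are forbidden only
across edges enclosed on both sides; this makes room to add the neighbour `x` of `u`. If `x` has no
chord, either the set from `exists_faceCutOnce` or that set with `x` added has the right parity.
Otherwise let `w` be the last neighbour of `x` along the path. On the side of `u` there is no
further chord at `x`, so `x` can be added there. The recursion on the other side, with `x` selected
and `w` not, adjusts the parity. -/
theorem Encloses.exists_faceCut_parity [Finite V] (n : ℕ) :
    ∀ {u v : V} {q : G.Walk u v} {h : G.Adj v u} {s : G.Dart → ZMod 2}, q.length = n →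
      P.Encloses (Walk.cons h q).edges s → (Walk.cons h q).IsCycle → ∀ ε : ZMod 2,
      ∃ B ⊆ {w | w ∈ q.support}, u ∈ B ∧ v ∉ B ∧ (B.ncard : ZMod 2) = ε ∧
        (∀ d, s d ≠ 0 → P.FaceCut B d) ∧
        ∀ d, s d ≠ 0 → s d.symm ≠ 0 → ¬(d.fst ∈ B ∧ d.snd ∈ B) := by
  induction n using Nat.strong_induction_on with
  | _ n ih =>
  intro u v q h s hn hs hc ε
  have hq := Walk.isPath_of_isCycle_cons hc
  have hl := Walk.two_le_length_of_isCycle_cons hc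
  have hβ : ¬(u ∈ ({u} : Set V) ∧ v ∈ ({u} : Set V)) := fun h' => h.ne h'.2
  cases q with
  | nil => simp at hl
  | @cons _ x _ h₁ q =>
  cases q with
  | nil => simp at hl
  | @cons _ y _ h₂ p =>
  have hxv : v ≠ x := by
    rintro rfl
    exact ((Walk.cons_isPath_iff _ _).1 ((Walk.cons_isPath_iff _ _).1 hq).1).2 p.end_mem_support
  obtain ⟨w, p₁, p₂, rfl, hxw, hlast⟩ :=
    p.exists_append_last (Q := G.Adj x) ⟨y, p.start_mem_support, h₂⟩
  cases p₁ with
  | nil =>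
    obtain ⟨B, hB, hu, hv, hd⟩ := hs.exists_faceCutOnce _ rfl hc hβ
    have hu' : u ∈ B := hu.2 rfl
    have hv' : v ∉ B := fun h' => h.ne (hv.1 h')
    by_cases hε : (B.ncard : ZMod 2) = ε
    · exact ⟨B, hB, hu', hv', hε, fun d hd' => (hd d hd').2.faceCut,
        fun d hd' _ => (hd d hd').1⟩
    · obtain ⟨hxB, -, h3, h4⟩ := hs.faceCut_insert hc hlast hu' hd
      refine ⟨insert x B, ?_, Or.inr hu', ?_, ?_, h3, h4⟩
      · rintro z (rfl | hz)
        · simp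
        · exact hB hz
      · rintro (h' | h')
        · exact hxv h'
        · exact hv' h'
      · rw [Set.ncard_insert_of_notMem hxB, Nat.cast_add, Nat.cast_one]
        have := ZMod.eq_one_of_ne_zero_two (sub_ne_zero.2 hε)
        have h2 : (2 : ZMod 2) = 0 := rfl
        linear_combination this + h2
  | @cons _ y' _ h₃ p₁ =>
    have hs' : P.Encloses (Walk.cons h ((Walk.cons h₁ Walk.nil).append
      ((Walk.cons h₂ (Walk.cons h₃ p₁)).append p₂))).edges s := hs
    have hq' : ((Walk.cons h₁ Walk.nil).append
      ((Walk.cons h₂ (Walk.cons h₃ p₁)).append p₂)).IsPath := hq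
    obtain ⟨s₁, s₂, hs₁, hs₂, hss⟩ := hs'.exists_split hxw
    have hc₁ : (Walk.cons h ((Walk.cons h₁ Walk.nil).append (Walk.cons hxw p₂))).IsCycle :=
      Walk.isCycle_cons_of_two_le (Walk.isPath_shortcut hq' hxw) h (by simp)
    have hc₂ : (Walk.cons hxw.symm (Walk.cons h₂ (Walk.cons h₃ p₁))).IsCycle :=
      Walk.isCycle_cons_of_two_le hq'.of_append_right.of_append_left hxw.symm (by simp)
    obtain ⟨B₁, hB₁, hu, hv, hd⟩ := hs₁.exists_faceCutOnce _ rfl hc₁ hβ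
    have hu' : u ∈ B₁ := hu.2 rfl
    have hv' : v ∉ B₁ := fun h' => h.ne (hv.1 h')
    obtain ⟨hxB, hwB, h3, h4⟩ := hs₁.faceCut_insert hc₁ hlast hu' hd
    -- The two sets will meet exactly in `x`, so their union has `(|B₁| + 1) + |B₂| - 1` elements.
    obtain ⟨B₂, hB₂, hxB₂, hwB₂, hcard, h5, h6⟩ := ih _ (by simp at hn ⊢; omega) rfl hs₂ hc₂
      (ε - (B₁.ncard : ZMod 2))
    have hwB' : w ∉ insert x B₁ := by
      rintro (h' | h')
      · exact hxw.ne h'.symm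
      · exact hwB h'
    have hB₁' : insert x B₁ ⊆ {z | z ∈ ((Walk.cons h₁ Walk.nil).append
        (Walk.cons hxw p₂)).support} := by
      rintro z (rfl | hz)
      · simp
      · exact hB₁ hz
    have hagree : ∀ z ∈ {z | z ∈ ((Walk.cons h₁ Walk.nil).append (Walk.cons hxw p₂)).support},
        z ∈ {z | z ∈ (Walk.cons h₂ (Walk.cons h₃ p₁)).support} →
        (z ∈ insert x B₁ ↔ z ∈ B₂) := by
      intro z hz hz'
      rcases Walk.mem_support_inter_of_isPath hq' hz hz' with rfl | rfl
      · exact iff_of_true (Set.mem_insert _ _) hxB₂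
      · exact iff_of_false hwB' hwB₂
    have hagree' := fun z h h' => (hagree z h' h).symm
    have hF₁ : ∀ {d}, s₁ d ≠ 0 → P.faceSet d ⊆
        {z | z ∈ ((Walk.cons h₁ Walk.nil).append (Walk.cons hxw p₂)).support} := fun hd =>
      Walk.support_cons_eq _ h ▸ hs₁.faceSet_subset hd
    have hF₂ : ∀ {d}, s₂ d ≠ 0 → P.faceSet d ⊆
        {z | z ∈ (Walk.cons h₂ (Walk.cons h₃ p₁)).support} := fun hd =>
      Walk.support_cons_eq _ hxw.symm ▸ hs₂.faceSet_subset hd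
    have hmem₁ : ∀ {z}, z ∈ ((Walk.cons h₁ Walk.nil).append (Walk.cons hxw p₂)).support →
        (z ∈ insert x B₁ ∪ B₂ ↔ z ∈ insert x B₁) := fun hz =>
      mem_union_iff_of_agree hB₂ hagree hz
    have hmem₂ : ∀ {z}, z ∈ (Walk.cons h₂ (Walk.cons h₃ p₁)).support →
        (z ∈ insert x B₁ ∪ B₂ ↔ z ∈ B₂) := fun hz => by
      rw [Set.union_comm]
      exact mem_union_iff_of_agree hB₁' hagree' hz
    have hor : ∀ {d}, s d ≠ 0 → s₁ d ≠ 0 ∨ s₂ d ≠ 0 := by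
      intro d hd
      by_contra! h'
      rw [hss, h'.1, h'.2, add_zero] at hd
      exact hd rfl
    -- Faces on different sides of the chord share at most `x` and `w`, and `w` is not selected. So
    -- an edge between two such faces has at most one selected end.
    have hmixed : ∀ {d d' : G.Dart}, s₁ d ≠ 0 → s₂ d' ≠ 0 → ∀ z ∈ P.faceSet d,
        z ∈ P.faceSet d' → z ∈ insert x B₁ ∪ B₂ → z = x := by
      intro d d' hd hd' z hz hz' hzB
      rcases Walk.mem_support_inter_of_isPath hq' (hF₁ hd hz) (hF₂ hd' hz') with h' | rfl
      · exact h'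
      · exact absurd ((hmem₁ (hF₁ hd hz)).1 hzB) hwB'
    refine ⟨insert x B₁ ∪ B₂, ?_, Or.inl (Or.inr hu'), ?_, ?_, ?_, ?_⟩
    · rintro z (hz | hz)
      · have := hB₁' hz
        simp only [Set.mem_ofPred_eq, Walk.mem_support_append_iff, Walk.support_cons,
          Walk.support_nil, List.mem_cons, List.not_mem_nil, or_false] at this ⊢
        tauto
      · have := hB₂ hz
        simp only [Set.mem_ofPred_eq, Walk.mem_support_append_iff, Walk.support_cons,
          List.mem_cons] at this ⊢
        tauto
    · rw [hmem₁ (Walk.end_mem_support _)]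
      rintro (h' | h')
      · exact hxv h'
      · exact hv' h'
    · have hinter : insert x B₁ ∩ B₂ = {x} := by
        ext z
        constructor
        · rintro ⟨hz₁, hz₂⟩
          rcases Walk.mem_support_inter_of_isPath hq' (hB₁' hz₁) (hB₂ hz₂) with h' | rfl
          · exact h'
          · exact absurd hz₂ hwB₂
        · rintro rfl
          exact ⟨Set.mem_insert _ _, hxB₂⟩
      have h7 := Set.ncard_union_add_ncard_inter (insert x B₁) B₂
      rw [hinter, Set.ncard_singleton, Set.ncard_insert_of_notMem hxB] at h7
      have h8 := congrArg (Nat.cast : ℕ → ZMod 2) h7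
      push_cast at h8
      rw [hcard] at h8
      linear_combination h8
    · intro d hd
      rcases hor hd with hd | hd
      · exact (h3 d hd).congr (inter_union_eq_of_agree hB₂ hagree (hF₁ hd))
      · refine (h5 d hd).congr ?_
        rw [Set.union_comm]
        exact inter_union_eq_of_agree hB₁' hagree' (hF₂ hd)
    · rintro d hd hd' ⟨hf, hg⟩
      rcases hor hd with hd | hd <;> rcases hor hd' with hd' | hd'
      · refine h4 d hd hd' ?_
        rw [← hmem₁ (hF₁ hd (P.fst_mem_faceSet d)), ← hmem₁ (hF₁ hd (P.snd_mem_faceSet d))]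
        exact ⟨hf, hg⟩
      · exact d.fst_ne_snd ((hmixed hd hd' _ (P.fst_mem_faceSet d) (P.snd_mem_faceSet d.symm)
          hf).trans (hmixed hd hd' _ (P.snd_mem_faceSet d) (P.fst_mem_faceSet d.symm) hg).symm)
      · exact d.fst_ne_snd ((hmixed hd' hd _ (P.snd_mem_faceSet d.symm) (P.fst_mem_faceSet d)
          hf).trans (hmixed hd' hd _ (P.fst_mem_faceSet d.symm) (P.snd_mem_faceSet d) hg).symm)
      · refine h6 d hd hd' ?_
        rw [← hmem₂ (hF₂ hd (P.fst_mem_faceSet d)), ← hmem₂ (hF₂ hd (P.snd_mem_faceSet d))]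
        exact ⟨hf, hg⟩

end OuterplaneEmbedding

/-- Two distinct entries of the list never alternate as `x, y, x, y`. -/
def List.NonCrossing {α : Type*} (l : List α) : Prop :=
  ∀ x y, [x, y, x, y].Sublist l → x = y

/-! ### Decomposing closed walks, and potentials along paths -/

namespace SimpleGraph

variable {V : Type*} {G : SimpleGraph V}

theorem parity_map_edge (l : List G.Dart) (d : G.Dart) :
    (l.map Dart.edge).parity d.edge = l.parity d + l.parity d.symm := by
  induction l with
  | nil => simp [List.parity_nil]
  | cons b l ih =>
    rw [List.map_cons, List.parity_cons, List.parity_cons b l d, List.parity_cons b l d.symm, ih]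
    have key : [b.edge].parity d.edge = [b].parity d + [b].parity d.symm := by
      by_cases h1 : d = b
      · subst h1
        rw [List.parity_of_mem (by simp) (by simp), List.parity_of_mem (by simp) (by simp),
          List.parity_of_notMem, add_zero]
        simpa using d.symm_ne
      · rw [List.parity_of_notMem (l := [b]) (a := d) (by simpa using h1), zero_add]
        by_cases h2 : d.symm = b
        · have h3 : d.edge = b.edge := by rw [← h2, Dart.edge_symm]
          rw [List.parity_of_mem (by simp) (by simpa using h3),
            List.parity_of_mem (by simp) (by simpa using h2)]
        · rw [List.parity_of_notMem (l := [b]) (a := d.symm) (by simpa using h2),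
            List.parity_of_notMem]
          rw [List.mem_singleton, dart_edge_eq_iff]
          rintro (h | h)
          · exact h1 h
          · exact h2 (by rw [h, Dart.symm_symm])
    rw [key]
    ring

namespace Walk

theorem sublist_support_of_mem {a b z : V} (p : G.Walk a b) (hz : z ∈ p.support) (hzb : z ≠ b) :
    [z, b].Sublist p.support := by
  classical
  rw [← take_spec p hz, support_append]
  exact List.Sublist.append (List.singleton_sublist.2 (end_mem_support _))
    (List.singleton_sublist.2 (end_mem_tail_support_of_ne hzb _))

/-- Every walk that is not a path has a closed subwalk without further repetitions. -/
theorem exists_append_cons_path {u v : V} (w : G.Walk u v) (hw : ¬w.IsPath) :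
    ∃ (x y : V) (p₁ : G.Walk u x) (h : G.Adj x y) (q : G.Walk y x) (p₂ : G.Walk x v),
      w = p₁.append ((cons h q).append p₂) ∧ q.IsPath := by
  classical
  induction w with
  | nil => exact absurd IsPath.nil hw
  | @cons a b v h p ih =>
    by_cases hp : p.IsPath
    · have ha : a ∈ p.support := by
        by_contra ha
        exact hw ((cons_isPath_iff h p).2 ⟨hp, ha⟩)
      refine ⟨a, b, nil, h, p.takeUntil a ha, p.dropUntil a ha, ?_, hp.takeUntil ha⟩
      rw [nil_append, cons_append, take_spec]
    · obtain ⟨x, y, p₁, h', q, p₂, rfl, hq⟩ := ih hp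
      exact ⟨x, y, cons h p₁, h', q, p₂, rfl, hq⟩

open Classical in
/-- Along a path, a function can be prescribed by its increments. -/
theorem exists_potential [Finite V] {a b : V} {q : G.Walk a b} (hq : q.IsPath) (B : Set V)
    (τ : ZMod 2) :
    ∃ t : V → ZMod 2, t a = τ ∧ (∀ d ∈ q.darts, t d.snd = t d.fst + B.indicator 1 d.snd) ∧
      t b + B.indicator 1 a = τ + (({w | w ∈ q.support} ∩ B).ncard : ZMod 2) := by
  induction q generalizing τ with
  | @nil a =>
    refine ⟨fun _ => τ, rfl, by simp, ?_⟩
    by_cases ha : a ∈ B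
    · have : {w | w ∈ (nil : G.Walk a a).support} ∩ B = {a} := by
        ext w
        simp only [support_nil, List.mem_singleton, Set.mem_inter_iff, Set.mem_ofPred_eq,
          Set.mem_singleton_iff, and_iff_left_iff_imp]
        rintro rfl
        exact ha
      rw [this]
      simp [ha]
    · have : {w | w ∈ (nil : G.Walk a a).support} ∩ B = ∅ := by
        ext w
        simp only [support_nil, List.mem_singleton, Set.mem_inter_iff, Set.mem_ofPred_eq,
          Set.mem_empty_iff_false, iff_false, not_and]
        rintro rfl
        exact ha
      rw [this]
      simp [ha]
  | @cons a c b h p ih =>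
    rw [cons_isPath_iff] at hq
    obtain ⟨t, ht, htd, htb⟩ := ih hq.1 (τ + B.indicator 1 c)
    have hne : ∀ z ∈ p.support, z ≠ a := by
      rintro z hz rfl
      exact hq.2 hz
    refine ⟨Function.update t a τ, by simp, ?_, ?_⟩
    · intro d hd
      rw [darts_cons, List.mem_cons] at hd
      rcases hd with rfl | hd
      · change Function.update t a τ c = Function.update t a τ a + _
        rw [Function.update_self, Function.update_of_ne h.ne', ht]
      · rw [Function.update_of_ne (hne _ (p.dart_snd_mem_support_of_mem_darts hd)),
          Function.update_of_ne (hne _ (p.dart_fst_mem_support_of_mem_darts hd)), htd d hd]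
    · rw [Function.update_of_ne (hne _ p.end_mem_support)]
      have h2 := CharTwo.add_self_eq_zero (B.indicator (1 : V → ZMod 2) c)
      by_cases ha : a ∈ B
      · have : {w | w ∈ (cons h p).support} ∩ B = insert a ({w | w ∈ p.support} ∩ B) := by
          ext w
          simp only [support_cons, List.mem_cons, Set.mem_inter_iff, Set.mem_ofPred_eq,
            Set.mem_insert_iff]
          constructor
          · tauto
          · rintro (rfl | hw)
            · exact ⟨Or.inl rfl, ha⟩
            · exact ⟨Or.inr hw.1, hw.2⟩
        rw [this, Set.ncard_insert_of_notMem (fun h' => hq.2 h'.1), Set.indicator_of_mem ha]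
        push_cast
        simp only [Pi.one_apply]
        linear_combination htb
      · have : {w | w ∈ (cons h p).support} ∩ B = {w | w ∈ p.support} ∩ B := by
          ext w
          simp only [support_cons, List.mem_cons, Set.mem_inter_iff, Set.mem_ofPred_eq]
          constructor
          · rintro ⟨rfl | hw, hwB⟩
            · exact absurd hwB ha
            · exact ⟨hw, hwB⟩
          · exact fun hw => ⟨Or.inr hw.1, hw.2⟩
        rw [this, Set.indicator_of_notMem ha]
        linear_combination htb

end Walk

end SimpleGraph

/-! ### The outer facial walk does not cross itself -/

namespace OuterplaneEmbedding

open SimpleGraph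

variable {V : Type*} {G : SimpleGraph V} (P : OuterplaneEmbedding G)

theorem iterate_faceStep_mem_outer {d : G.Dart} (hd : d ∈ P.outer) (n : ℕ) :
    P.faceStep^[n] d ∈ P.outer := by
  induction n with
  | zero => exact hd
  | succ n ih => rwa [Function.iterate_succ_apply', faceStep_mem_outer_iff]

theorem exists_walk_of_iterate_faceStep (d : G.Dart) (n : ℕ) :
    ∃ w : G.Walk d.fst (P.faceStep^[n] d).fst,
      w.darts = (List.range n).map fun m => P.faceStep^[m] d := by
  induction n with
  | zero => exact ⟨Walk.nil, rfl⟩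
  | succ n ih =>
    obtain ⟨w, hw⟩ := ih
    have heq : (P.faceStep^[n + 1] d).fst = (P.faceStep^[n] d).snd := by
      rw [Function.iterate_succ_apply', P.fst_faceStep]
    have h : G.Adj (P.faceStep^[n] d).fst (P.faceStep^[n + 1] d).fst := by
      rw [heq]
      exact (P.faceStep^[n] d).adj
    refine ⟨w.concat h, ?_⟩
    rw [Walk.darts_concat, hw, List.concat_eq_append, List.range_succ, List.map_append]
    congr 1
    simp only [List.map_cons, List.map_nil, List.cons.injEq, and_true]
    exact Dart.ext _ _ (Prod.ext rfl heq)

/-- The facial walk on the outer face does not cross itself. -/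
theorem nonCrossing_outer [Finite V] {d : G.Dart} (hd : d ∈ P.outer) {n : ℕ}
    (hn : P.faceStep^[n] d = d)
    (hinj : ∀ i < n, ∀ j < n, P.faceStep^[i] d = P.faceStep^[j] d → i = j) :
    ((List.range (n + 1)).map fun m => (P.faceStep^[m] d).fst).NonCrossing := by
  classical
  intro x y hxy
  by_contra hne
  obtain ⟨l', hl', heq⟩ := List.sublist_map_iff.1 hxy
  obtain ⟨i, j, k, l, rfl⟩ : ∃ i j k l, l' = [i, j, k, l] := by
    rcases l' with _ | ⟨i, _ | ⟨j, _ | ⟨k, _ | ⟨l, _ | ⟨_, _⟩⟩⟩⟩⟩ <;>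
      simp only [List.map_cons, List.map_nil, List.cons.injEq, reduceCtorEq, and_false] at heq
    exact ⟨i, j, k, l, rfl⟩
  simp only [List.map_cons, List.map_nil, List.cons.injEq, and_true] at heq
  obtain ⟨hi, hj, hk, hl⟩ := heq
  have hlt := List.pairwise_lt_range.sublist hl'
  simp only [List.pairwise_cons, List.mem_cons, List.not_mem_nil, or_false] at hlt
  have hij : i < j := hlt.1 j (Or.inl rfl)
  have hjk : j < k := hlt.2.1 k (Or.inl rfl)
  have hkl : k < l := hlt.2.2.1 l rfl
  have hln : l ≤ n := by
    have := hl'.subset (show l ∈ [i, j, k, l] by simp)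
    rw [List.mem_range] at this
    omega
  -- The closed part of the walk between two visits to `x`. It contains the dart of visit `j` to
  -- `y`, but not that of visit `l`.
  set σ : List G.Dart := (List.range (k - i)).map fun m => P.faceStep^[m] (P.faceStep^[i] d)
    with hσ
  have hmem : ∀ e, e ∈ σ ↔ ∃ m, i ≤ m ∧ m < k ∧ P.faceStep^[m] d = e := by
    intro e
    rw [hσ, List.mem_map]
    constructor
    · rintro ⟨m, hm, rfl⟩
      rw [List.mem_range] at hm
      exact ⟨m + i, by omega, by omega, Function.iterate_add_apply _ _ _ _⟩
    · rintro ⟨m, h1, h2, rfl⟩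
      refine ⟨m - i, List.mem_range.2 (by omega), ?_⟩
      rw [← Function.iterate_add_apply, Nat.sub_add_cancel h1]
  have hnodup : σ.Nodup := by
    refine List.Nodup.map_on (fun a ha b hb hab => ?_) List.nodup_range
    rw [List.mem_range] at ha hb
    rw [← Function.iterate_add_apply, ← Function.iterate_add_apply] at hab
    have := hinj _ (by omega) _ (by omega) hab
    omega
  have hσo : ∀ e, e ∉ P.outer → σ.parity e = 0 := by
    intro e he
    refine List.parity_of_notMem fun h' => he ?_
    obtain ⟨m, -, -, rfl⟩ := (hmem e).1 h'
    exact P.iterate_faceStep_mem_outer hd m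
  obtain ⟨s, hs⟩ : ∃ s, P.Encloses (σ.map Dart.edge) s := by
    obtain ⟨w, hw⟩ := P.exists_walk_of_iterate_faceStep (P.faceStep^[i] d) (k - i)
    have hend : (P.faceStep^[k - i] (P.faceStep^[i] d)).fst = (P.faceStep^[i] d).fst := by
      rw [← Function.iterate_add_apply, Nat.sub_add_cancel (by omega), ← hk, ← hi]
    obtain ⟨s, hs⟩ := P.exists_encloses (w.copy rfl hend)
    refine ⟨s, ?_⟩
    rwa [Walk.edges_copy, Walk.edges, hw] at hs
  have hadd : ∀ e, s e + s e.symm = σ.parity e + σ.parity e.symm := by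
    intro e
    rw [hs.add_symm, parity_map_edge]
  have hstep : ∀ e, e.snd = y → σ.parity (P.faceStep e) = σ.parity e := by
    intro e hey
    have hiff : P.faceStep e ∈ σ ↔ e ∈ σ := by
      rw [hmem, hmem]
      constructor
      · rintro ⟨m, h1, h2, h3⟩
        rcases h1.eq_or_lt with rfl | h1
        · refine absurd ?_ hne
          rw [hi, h3, P.fst_faceStep, hey]
        · refine ⟨m - 1, by omega, by omega, P.faceStep.injective ?_⟩
          have h4 : P.faceStep^[m - 1 + 1] d = _ := Function.iterate_succ_apply' _ _ _
          rw [← h4, Nat.sub_add_cancel (by omega), h3]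
      · rintro ⟨m, h1, h2, rfl⟩
        rcases (show m + 1 ≤ k from h2).eq_or_lt with rfl | h2
        · refine absurd ?_ hne
          rw [hk, Function.iterate_succ_apply', P.fst_faceStep, hey]
        · exact ⟨m + 1, by omega, h2, Function.iterate_succ_apply' _ _ _⟩
    by_cases he : e ∈ σ
    · rw [List.parity_of_mem hnodup he, List.parity_of_mem hnodup (hiff.2 he)]
    · rw [List.parity_of_notMem he, List.parity_of_notMem fun h' => he (hiff.1 h')]
  -- This function is constant around `y`, although visits `j` and `l` require different values.
  -- Across an edge, `s` changes by the parities in `σ` of its two darts. At an outer corner, where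
  -- `s` vanishes, membership in `σ` takes over; it is the same for the arriving and the leaving
  -- dart because `σ` starts and ends at `x ≠ y`.
  let a : G.Dart → ZMod 2 := fun e => if e ∈ P.outer then σ.parity e else s e
  have ha : ∀ z : G.Dart, z.fst = y → a (P.next z) = a z := by
    intro z hz
    have hzn : P.next z = P.faceStep z.symm := by rw [P.faceStep_apply, Dart.symm_symm]
    have h1 := hadd z
    rw [hzn]
    simp only [a, faceStep_mem_outer_iff]
    rw [hstep z.symm hz, hs.faceStep]
    by_cases hzo : z ∈ P.outer <;> by_cases hzo' : z.symm ∈ P.outer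
    · rw [if_pos hzo, if_pos hzo']
      rw [hs.outer z hzo, hs.outer z.symm hzo', add_zero] at h1
      exact (CharTwo.add_eq_zero.1 h1.symm).symm
    · rw [if_pos hzo, if_neg hzo']
      rw [hs.outer z hzo, hσo _ hzo', zero_add, add_zero] at h1
      exact h1
    · rw [if_neg hzo, if_pos hzo']
      rw [hs.outer _ hzo', hσo _ hzo, zero_add, add_zero] at h1
      exact h1.symm
    · rw [if_neg hzo, if_neg hzo']
      rw [hσo _ hzo, hσo _ hzo', add_zero] at h1
      exact (CharTwo.add_eq_zero.1 h1).symm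
  have hkey := (Equiv.Perm.SameCycle.apply_eq (s := {z : G.Dart | z.fst = y}) (f := a)
    (fun z hz => by simpa [P.fst_next] using hz) (fun z hz => by simpa [P.fst_next] using hz) ha
    (P.sameCycle_next (P.faceStep^[j] d) (P.faceStep^[l] d) (hj.symm.trans hl)) hj.symm).1
  simp only [a, if_pos (P.iterate_faceStep_mem_outer hd _)] at hkey
  rw [List.parity_of_mem hnodup ((hmem _).2 ⟨j, hij.le, hjk, rfl⟩), List.parity_of_notMem] at hkey
  · exact zero_ne_one hkey
  · intro h'
    obtain ⟨m, h1, h2, h3⟩ := (hmem _).1 h'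
    -- Index `n` is the return to the start, with the same dart as index 0. That dart is in `σ` only
    -- if `i = 0`, and then `x = y`.
    rcases hln.eq_or_lt with rfl | hln
    · rw [hn] at h3
      have hm := hinj m (by omega) 0 (by omega) h3
      have hi0 : i = 0 := by omega
      subst hi0
      refine hne ?_
      rw [hi, hl, hn]
      rfl
    · have := hinj m (by omega) l hln h3
      omega

/-- The facial walk on the outer face of a component. -/
theorem exists_outer_walk [Finite V] {d : G.Dart} (hd : d ∈ P.outer) :
    ∃ w : G.Walk d.fst d.fst, w.darts.Nodup ∧ (∀ e, e ∈ w.darts ↔ e ∈ P.facialWalk d) ∧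
      w.support.NonCrossing := by
  set n := Function.minimalPeriod P.faceStep d with hn
  have hper : P.faceStep^[n] d = d := Function.iterate_minimalPeriod
  have hpos : 0 < n := Function.minimalPeriod_pos_of_mem_periodicPts
    (P.faceStep.injective.mem_periodicPts d)
  have hinj : ∀ i < n, ∀ j < n, P.faceStep^[i] d = P.faceStep^[j] d → i = j :=
    fun i hi j hj hij => Function.iterate_injOn_Iio_minimalPeriod hi hj hij
  obtain ⟨w, hw⟩ := P.exists_walk_of_iterate_faceStep d n
  have hend : (P.faceStep^[n] d).fst = d.fst := by rw [hper]
  refine ⟨w.copy rfl hend, ?_, ?_, ?_⟩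
  · rw [Walk.darts_copy, hw]
    exact List.Nodup.map_on (fun a ha b hb hab =>
      hinj a (List.mem_range.1 ha) b (List.mem_range.1 hb) hab) List.nodup_range
  · intro e
    rw [Walk.darts_copy, hw, List.mem_map]
    constructor
    · rintro ⟨m, -, rfl⟩
      refine ⟨m, ?_⟩
      rw [zpow_natCast, Equiv.Perm.iterate_eq_pow]
    · intro he
      obtain ⟨m, hm⟩ := Equiv.Perm.SameCycle.exists_nat_pow_eq he
      refine ⟨m % n, List.mem_range.2 (Nat.mod_lt _ hpos), ?_⟩
      rw [hn, Function.iterate_mod_minimalPeriod_eq, Equiv.Perm.iterate_eq_pow, hm]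
  · rw [Walk.support_copy, ← Walk.map_fst_darts_append, hw, List.map_map]
    have := P.nonCrossing_outer hd hper hinj
    rw [List.range_succ, List.map_append] at this
    exact this

end OuterplaneEmbedding

/-! ### Building the set and the potential along a closed walk -/

namespace OuterplaneEmbedding

open SimpleGraph

variable {V : Type*} {G : SimpleGraph V} {P : OuterplaneEmbedding G}

/-- A blocking set for a cycle that is prescribed at one vertex `x`. -/
theorem Encloses.exists_faceCut_even [Finite V] {x y : V} {q : G.Walk y x} {h : G.Adj x y}
    {s : G.Dart → ZMod 2} (hs : P.Encloses (Walk.cons h q).edges s)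
    (hc : (Walk.cons h q).IsCycle) (B' : Set V) :
    ∃ B ⊆ {w | w ∈ q.support}, (x ∈ B' ↔ x ∈ B) ∧ (B.ncard : ZMod 2) = 0 ∧
      (∀ d, s d ≠ 0 → P.FaceCut B d) ∧
      ∀ d, s d ≠ 0 → s d.symm ≠ 0 → ¬(d.fst ∈ B ∧ d.snd ∈ B) := by
  -- `exists_faceCut_parity` selects the first vertex of the path and not the last one. Reversing
  -- the path decides which of them `x` is.
  by_cases hx : x ∈ B'
  · have hs' : P.Encloses (Walk.cons h.symm q.reverse).edges s := by
      refine hs.congr fun e => ?_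
      rw [Walk.edges_cons, Walk.edges_cons, Walk.edges_reverse, Sym2.eq_swap, List.parity_cons,
        List.parity_cons _ q.edges.reverse, List.parity_reverse]
    have hc' : (Walk.cons h.symm q.reverse).IsCycle :=
      Walk.isCycle_cons_of_two_le (Walk.isPath_of_isCycle_cons hc).reverse h.symm (by
        rw [Walk.length_reverse]
        exact Walk.two_le_length_of_isCycle_cons hc)
    obtain ⟨B, hB, hxB, -, h1, h2, h3⟩ := hs'.exists_faceCut_parity _ rfl hc' 0
    exact ⟨B, by simpa using hB, iff_of_true hx hxB, h1, h2, h3⟩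
  · obtain ⟨B, hB, -, hxB, h1, h2, h3⟩ := hs.exists_faceCut_parity _ rfl hc 0
    exact ⟨B, hB, iff_of_false hx hxB, h1, h2, h3⟩

variable (P)

/-- `B` is good for the faces enclosed by `L`. -/
def CutsInside (L : List (Sym2 V)) (B : Set V) : Prop :=
  ∀ s, P.Encloses L s → (∀ d, s d ≠ 0 → P.FaceCut B d) ∧
    ∀ d, s d ≠ 0 → s d.symm ≠ 0 → ¬(d.fst ∈ B ∧ d.snd ∈ B)

variable {P}

open Classical in
/-- Adding a pendant edge to a closed walk. -/
theorem CutsInside.exists_of_pendant [Finite V] {u x y : V} {p₁ : G.Walk u x} {p₂ : G.Walk x u}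
    {h : G.Adj x y} {h' : G.Adj y x} (hy : y ∉ (p₁.append p₂).support) {B : Set V}
    (hB : B ⊆ {w | w ∈ (p₁.append p₂).support}) {t : V → ZMod 2}
    (ht : ∀ d ∈ (p₁.append p₂).darts, t d.snd = t d.fst + B.indicator 1 d.snd)
    (hcut : P.CutsInside (p₁.append p₂).edges B) :
    ∃ B' ⊆ {w | w ∈ (p₁.append ((Walk.cons h (Walk.cons h' Walk.nil)).append p₂)).support},
      ∃ t' : V → ZMod 2,
      (∀ d ∈ (p₁.append ((Walk.cons h (Walk.cons h' Walk.nil)).append p₂)).darts,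
        t' d.snd = t' d.fst + B'.indicator 1 d.snd) ∧
      P.CutsInside (p₁.append ((Walk.cons h (Walk.cons h' Walk.nil)).append p₂)).edges B' := by
  have hyB : y ∉ B := fun hyB => hy (hB hyB)
  -- The new vertex `y` copies the status of `x`, so that the increments of the potential from `x`
  -- to `y` and back cancel.
  obtain ⟨B', hB', hne, hyx⟩ : ∃ B' : Set V, B' ⊆ insert y B ∧
      (∀ z, z ≠ y → (z ∈ B' ↔ z ∈ B)) ∧ (y ∈ B' ↔ x ∈ B) := by
    by_cases hx : x ∈ B
    · exact ⟨insert y B, subset_rfl, fun z hz => by simp [hz], by simp [hx]⟩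
    · exact ⟨B, Set.subset_insert _ _, fun z hz => Iff.rfl, iff_of_false hyB hx⟩
  have hind : ∀ z, z ≠ y → B'.indicator (1 : V → ZMod 2) z = B.indicator 1 z := by
    intro z hz
    by_cases hzB : z ∈ B
    · rw [Set.indicator_of_mem hzB, Set.indicator_of_mem ((hne z hz).2 hzB)]
    · rw [Set.indicator_of_notMem hzB, Set.indicator_of_notMem fun h => hzB ((hne z hz).1 h)]
  have hindy : B'.indicator (1 : V → ZMod 2) y = B.indicator 1 x := by
    by_cases hx : x ∈ B
    · rw [Set.indicator_of_mem hx, Set.indicator_of_mem (hyx.2 hx)]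
      rfl
    · rw [Set.indicator_of_notMem hx, Set.indicator_of_notMem fun h => hx (hyx.1 h)]
  have hsuppy : ∀ z ∈ (p₁.append p₂).support, z ≠ y := by
    rintro z hz rfl
    exact hy hz
  refine ⟨B', ?_, Function.update t y (t x + B.indicator 1 x), ?_, ?_⟩
  · intro z hz
    have h1 := hB' hz
    simp only [Set.mem_ofPred_eq, Walk.mem_support_append_iff, Walk.support_cons,
      Walk.support_nil, List.mem_cons]
    rcases h1 with rfl | h1
    · simp
    · have := hB h1
      rw [Set.mem_ofPred_eq, Walk.mem_support_append_iff] at this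
      tauto
  · intro d hd
    simp only [Walk.darts_append, Walk.darts_cons, Walk.darts_nil, List.mem_append, List.mem_cons,
      List.not_mem_nil, or_false] at hd
    have h2 := CharTwo.add_self_eq_zero (B.indicator (1 : V → ZMod 2) x)
    have hmain : d ∈ (p₁.append p₂).darts →
        Function.update t y (t x + B.indicator 1 x) d.snd =
        Function.update t y (t x + B.indicator 1 x) d.fst + B'.indicator 1 d.snd := by
      intro hd
      have hd1 := hsuppy _ ((p₁.append p₂).dart_fst_mem_support_of_mem_darts hd)
      have hd2 := hsuppy _ ((p₁.append p₂).dart_snd_mem_support_of_mem_darts hd)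
      rw [Function.update_of_ne hd1, Function.update_of_ne hd2, hind _ hd2, ht d hd]
    rcases hd with hd | (rfl | rfl) | hd
    · exact hmain (by simp [hd])
    · change Function.update t y _ y = Function.update t y _ x + B'.indicator 1 y
      rw [Function.update_self, Function.update_of_ne h.ne, hindy]
    · change Function.update t y _ x = Function.update t y _ y + B'.indicator 1 x
      rw [Function.update_self, Function.update_of_ne h.ne, hind x h.ne]
      linear_combination -h2
    · exact hmain (by simp [hd])
  · intro s hs
    have hs' : P.Encloses (p₁.append p₂).edges s := by
      refine hs.congr fun e => ?_
      simp only [Walk.edges_append, Walk.edges_cons, Walk.edges_nil, List.parity_append]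
      rw [List.parity_cons s(x, y), Sym2.eq_swap (a := y) (b := x)]
      linear_combination CharTwo.add_self_eq_zero ([s(x, y)].parity e)
    have hF : ∀ {d}, s d ≠ 0 → ∀ z ∈ P.faceSet d, (z ∈ B' ↔ z ∈ B) := fun hd z hz =>
      hne z (hsuppy z (hs'.faceSet_subset hd hz))
    refine ⟨fun d hd => ((hcut s hs').1 d hd).congr ?_, fun d hd hd' => ?_⟩
    · ext z
      simp only [Set.mem_inter_iff, and_congr_right_iff]
      exact hF hd z
    · rw [hF hd _ (P.fst_mem_faceSet d), hF hd _ (P.snd_mem_faceSet d)]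
      exact (hcut s hs').2 d hd hd'

open Classical in
/-- Adding a cycle to a closed walk. -/
theorem CutsInside.exists_of_cycle [Finite V] {u x y : V} {p₁ : G.Walk u x} {p₂ : G.Walk x u}
    {h : G.Adj x y} {q : G.Walk y x} (hc : (Walk.cons h q).IsCycle)
    (hq : ∀ z ∈ q.support, z ∈ (p₁.append p₂).support → z = x) {B : Set V}
    (hB : B ⊆ {w | w ∈ (p₁.append p₂).support}) {t : V → ZMod 2}
    (ht : ∀ d ∈ (p₁.append p₂).darts, t d.snd = t d.fst + B.indicator 1 d.snd)
    (hcut : P.CutsInside (p₁.append p₂).edges B) :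
    ∃ B' ⊆ {w | w ∈ (p₁.append ((Walk.cons h q).append p₂)).support},
      ∃ t' : V → ZMod 2,
      (∀ d ∈ (p₁.append ((Walk.cons h q).append p₂)).darts,
        t' d.snd = t' d.fst + B'.indicator 1 d.snd) ∧
      P.CutsInside (p₁.append ((Walk.cons h q).append p₂)).edges B' := by
  have hpath := Walk.isPath_of_isCycle_cons hc
  obtain ⟨s₂, hs₂⟩ := P.exists_encloses (Walk.cons h q)
  obtain ⟨B₂, hB₂, hx₂, hcard, hcut₂, hcut₂'⟩ := hs₂.exists_faceCut_even hc B
  -- The starting value at `y` is forced by the dart from `x` to `y`. As `B₂` has even size, the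
  -- potential returns to `x` with the value `t x`.
  obtain ⟨t₂, hty, ht₂, htx⟩ := Walk.exists_potential hpath B₂ (t x + B₂.indicator 1 y)
  rw [Set.inter_eq_right.2 hB₂, hcard, add_zero] at htx
  replace htx : t₂ x = t x := add_right_cancel htx
  have hagree : ∀ z ∈ {w | w ∈ (p₁.append p₂).support}, z ∈ {w | w ∈ q.support} →
      (z ∈ B ↔ z ∈ B₂) := by
    intro z hz hz'
    rw [hq z hz' hz]
    exact hx₂
  have hagree' := fun z h h' => (hagree z h' h).symm
  have hxs : x ∈ (p₁.append p₂).support := by simp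
  have hmem₁ : ∀ {z}, z ∈ (p₁.append p₂).support → (z ∈ B ∪ B₂ ↔ z ∈ B) := fun hz =>
    mem_union_iff_of_agree hB₂ hagree hz
  have hmem₂ : ∀ {z}, z ∈ q.support → (z ∈ B ∪ B₂ ↔ z ∈ B₂) := fun hz => by
    rw [Set.union_comm]
    exact mem_union_iff_of_agree hB hagree' hz
  have hind₁ : ∀ {z}, z ∈ (p₁.append p₂).support →
      (B ∪ B₂).indicator (1 : V → ZMod 2) z = B.indicator 1 z := fun hz => by
    simp only [Set.indicator_apply, hmem₁ hz]
  have hind₂ : ∀ {z}, z ∈ q.support →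
      (B ∪ B₂).indicator (1 : V → ZMod 2) z = B₂.indicator 1 z := fun hz => by
    simp only [Set.indicator_apply, hmem₂ hz]
  let t' : V → ZMod 2 := fun z => if z ∈ q.support then t₂ z else t z
  have ht'₁ : ∀ {z}, z ∈ (p₁.append p₂).support → t' z = t z := by
    intro z hz
    by_cases hz' : z ∈ q.support
    · simp only [t', if_pos hz']
      rw [hq z hz' hz, htx]
    · simp only [t', if_neg hz']
  have ht'₂ : ∀ {z}, z ∈ q.support → t' z = t₂ z := fun hz => if_pos hz
  refine ⟨B ∪ B₂, ?_, t', ?_, ?_⟩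
  · rintro z (hz | hz)
    · have := hB hz
      simp only [Set.mem_ofPred_eq, Walk.mem_support_append_iff] at this ⊢
      tauto
    · have := hB₂ hz
      simp only [Set.mem_ofPred_eq, Walk.mem_support_append_iff, Walk.support_cons,
        List.mem_cons] at this ⊢
      tauto
  · intro d hd
    simp only [Walk.darts_append, Walk.darts_cons, List.mem_append, List.mem_cons] at hd
    have hmain : d ∈ (p₁.append p₂).darts →
        t' d.snd = t' d.fst + (B ∪ B₂).indicator 1 d.snd := by
      intro hd
      have hd1 := (p₁.append p₂).dart_fst_mem_support_of_mem_darts hd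
      have hd2 := (p₁.append p₂).dart_snd_mem_support_of_mem_darts hd
      rw [ht'₁ hd1, ht'₁ hd2, hind₁ hd2, ht d hd]
    rcases hd with hd | (rfl | hd) | hd
    · exact hmain (by simp [hd])
    · change t' y = t' x + (B ∪ B₂).indicator 1 y
      rw [ht'₂ q.start_mem_support, ht'₁ hxs, hind₂ q.start_mem_support, hty]
    · have hd1 := q.dart_fst_mem_support_of_mem_darts hd
      have hd2 := q.dart_snd_mem_support_of_mem_darts hd
      rw [ht'₂ hd1, ht'₂ hd2, hind₂ hd2, ht₂ d hd]
    · exact hmain (by simp [hd])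
  · intro s hs
    obtain ⟨s₁, hs₁⟩ := P.exists_encloses (p₁.append p₂)
    have hss : ∀ d, s d = s₁ d + s₂ d := by
      refine hs.unique (hs₁.add hs₂) fun d => ?_
      simp only [Walk.edges_append, List.parity_append]
      ring
    have hF₁ : ∀ {d}, s₁ d ≠ 0 → P.faceSet d ⊆ {w | w ∈ (p₁.append p₂).support} := fun hd =>
      hs₁.faceSet_subset hd
    have hF₂ : ∀ {d}, s₂ d ≠ 0 → P.faceSet d ⊆ {w | w ∈ q.support} := fun hd =>
      Walk.support_cons_eq q h ▸ hs₂.faceSet_subset hd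
    have hor : ∀ {d}, s d ≠ 0 → s₁ d ≠ 0 ∨ s₂ d ≠ 0 := by
      intro d hd
      by_contra! h'
      rw [hss, h'.1, h'.2, add_zero] at hd
      exact hd rfl
    have hmixed : ∀ {d d' : G.Dart}, s₁ d ≠ 0 → s₂ d' ≠ 0 → ∀ z ∈ P.faceSet d,
        z ∈ P.faceSet d' → z = x := fun hd hd' z hz hz' => hq z (hF₂ hd' hz') (hF₁ hd hz)
    refine ⟨fun d hd => ?_, fun d hd hd' => ?_⟩
    · rcases hor hd with hd | hd
      · exact ((hcut s₁ hs₁).1 d hd).congr (inter_union_eq_of_agree hB₂ hagree (hF₁ hd))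
      · refine (hcut₂ d hd).congr ?_
        rw [Set.union_comm]
        exact inter_union_eq_of_agree hB hagree' (hF₂ hd)
    · rcases hor hd with hd | hd <;> rcases hor hd' with hd' | hd'
      · rw [hmem₁ (hF₁ hd (P.fst_mem_faceSet d)), hmem₁ (hF₁ hd (P.snd_mem_faceSet d))]
        exact (hcut s₁ hs₁).2 d hd hd'
      · exact absurd ((hmixed hd hd' _ (P.fst_mem_faceSet d) (P.snd_mem_faceSet d.symm)).trans
          (hmixed hd hd' _ (P.snd_mem_faceSet d) (P.fst_mem_faceSet d.symm)).symm) d.fst_ne_snd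
      · exact absurd ((hmixed hd' hd _ (P.snd_mem_faceSet d.symm) (P.fst_mem_faceSet d)).trans
          (hmixed hd' hd _ (P.fst_mem_faceSet d.symm) (P.snd_mem_faceSet d)).symm) d.fst_ne_snd
      · rw [hmem₂ (hF₂ hd (P.fst_mem_faceSet d)), hmem₂ (hF₂ hd (P.snd_mem_faceSet d))]
        exact hcut₂' d hd hd'

/-- Induction on the length: a closed subwalk without further repetitions is removed and put back as
a pendant edge or as a cycle. Arbitrary non-crossing closed walks are allowed because this class is
stable under such removals. -/
theorem exists_cutsInside [Finite V] (P : OuterplaneEmbedding G) (n : ℕ) :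
    ∀ {u : V} {w : G.Walk u u}, w.length = n → w.support.NonCrossing →
      ∃ B ⊆ {x | x ∈ w.support}, ∃ t : V → ZMod 2,
        (∀ d ∈ w.darts, t d.snd = t d.fst + B.indicator 1 d.snd) ∧ P.CutsInside w.edges B := by
  induction n using Nat.strong_induction_on with
  | _ n ih =>
  intro u w hn hw
  by_cases hpath : w.IsPath
  · have hnil := (Walk.isPath_iff_nil).1 hpath
    cases w with
    | nil =>
      refine ⟨∅, Set.empty_subset _, fun _ => 0, by simp, fun s hs => ?_⟩
      have h0 : ∀ d, s d = 0 := fun d => hs.eq_zero_of_notMem (by simp)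
      exact ⟨fun d hd => absurd (h0 d) hd, fun d hd => absurd (h0 d) hd⟩
    | cons h p => simp at hnil
  · obtain ⟨x, y, p₁, h, q, p₂, rfl, hq⟩ := w.exists_append_cons_path hpath
    have hsupp : (p₁.append ((Walk.cons h q).append p₂)).support =
        p₁.support ++ (q.support ++ p₂.support.tail) := by
      rw [Walk.support_append, Walk.support_append, Walk.support_cons, List.cons_append,
        List.tail_cons]
    rw [hsupp] at hw
    -- A second common vertex `z` would produce the alternation `z, x, z, x` or `x, z, x, z`.
    have hqx : ∀ z ∈ q.support, z ∈ (p₁.append p₂).support → z = x := by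
      intro z hz hz'
      by_contra hzx
      have h1 := q.sublist_support_of_mem hz hzx
      rw [Walk.support_append, List.mem_append] at hz'
      rcases hz' with hz' | hz'
      · refine hzx (hw z x ?_)
        exact (p₁.sublist_support_of_mem hz' hzx).append
          (h1.trans (List.sublist_append_left _ _))
      · refine hzx (hw x z ?_).symm
        exact (List.singleton_sublist.2 p₁.end_mem_support).append
          (h1.append (List.singleton_sublist.2 hz'))
    have hw' : (p₁.append p₂).support.NonCrossing := by
      intro a b hab
      refine hw a b (hab.trans ?_)
      rw [Walk.support_append]
      exact (List.Sublist.refl _).append (List.sublist_append_right _ _)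
    simp only [Walk.length_append, Walk.length_cons] at hn
    obtain ⟨B, hB, t, ht, hcut⟩ := ih _ (by rw [Walk.length_append]; omega) rfl hw'
    by_cases hl : 2 ≤ q.length
    · exact hcut.exists_of_cycle (Walk.isCycle_cons_of_two_le hq h hl) hqx hB ht
    · cases q with
      | nil => exact absurd rfl h.ne
      | cons h' p =>
        cases p with
        | nil => exact hcut.exists_of_pendant (fun hy => h.ne' (hqx y (by simp) hy)) hB ht
        | cons => simp at hl

end OuterplaneEmbedding

/-! ### The set for the whole graph, and what is left of its cycles -/

namespace OuterplaneEmbedding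

open SimpleGraph

variable {V : Type*} {G : SimpleGraph V} (P : OuterplaneEmbedding G)

open Classical in
theorem exists_faceCut_component [Finite V] (c : G.ConnectedComponent) :
    ∃ (B : Set V) (t : V → ZMod 2), ∀ d : G.Dart, d.fst ∈ c.supp →
      (d ∈ P.outer → t d.snd = t d.fst + B.indicator 1 d.snd) ∧
      (d ∉ P.outer → P.FaceCut B d) ∧
      (d ∉ P.outer → d.symm ∉ P.outer → ¬(d.fst ∈ B ∧ d.snd ∈ B)) := by
  by_cases hc : ∃ d : G.Dart, d.fst ∈ c.supp
  swap
  · push Not at hc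
    exact ⟨∅, 0, fun d hd => absurd hd (hc d)⟩
  obtain ⟨d₀, hd₀⟩ := hc
  obtain ⟨o, ho, hod⟩ := P.exists_mem_outer d₀
  have hoc : G.connectedComponentMk o.fst = c := by rwa [hod]
  obtain ⟨w, hnodup, hmem, hw⟩ := P.exists_outer_walk ho
  obtain ⟨B, -, t, ht, hcut⟩ := P.exists_cutsInside _ rfl hw
  have hmemw : ∀ e : G.Dart, e ∈ w.darts ↔ e ∈ P.outer ∧ e.fst ∈ c.supp := by
    intro e
    rw [hmem, ConnectedComponent.mem_supp_iff]
    constructor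
    · intro he
      have hr := P.reachable_of_mem_facialWalk he
      exact ⟨(P.mem_outer_iff o e hr ho).2 he, hoc ▸ ConnectedComponent.sound hr.symm⟩
    · rintro ⟨he, hec⟩
      exact (P.mem_outer_iff o e (ConnectedComponent.exact (hoc.trans hec.symm)) ho).1 he
  have hsnd : ∀ d : G.Dart, d.snd ∈ c.supp ↔ d.fst ∈ c.supp := by
    intro d
    rw [ConnectedComponent.mem_supp_iff, ConnectedComponent.mem_supp_iff,
      ConnectedComponent.sound d.adj.reachable]
  -- The walk `w` uses each outer dart of the component exactly once, so what it encloses is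
  -- precisely the inner faces of the component.
  let s : G.Dart → ZMod 2 := fun d => if d ∉ P.outer ∧ d.fst ∈ c.supp then 1 else 0
  have hs : P.Encloses w.edges s := by
    refine ⟨fun d => ?_, fun d hd => ?_, fun d => ?_⟩
    · simp only [s, faceStep_mem_outer_iff, P.fst_faceStep, hsnd]
    · simp [s, hd]
    · rw [Walk.edges, parity_map_edge]
      have hpar : ∀ e, w.darts.parity e = if e ∈ P.outer ∧ e.fst ∈ c.supp then 1 else 0 := by
        intro e
        split_ifs with he
        · exact List.parity_of_mem hnodup ((hmemw e).2 he)
        · exact List.parity_of_notMem fun h => he ((hmemw e).1 h)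
      have hsymm : d.symm.fst ∈ c.supp ↔ d.fst ∈ c.supp := hsnd d
      rw [hpar, hpar]
      simp only [s, hsymm]
      have h2 : (1 + 1 : ZMod 2) = 0 := rfl
      by_cases h0 : d.fst ∈ c.supp <;> by_cases h1 : d ∈ P.outer <;>
        by_cases h2 : d.symm ∈ P.outer <;> simp [h0, h1, h2, CharTwo.add_self_eq_zero]
  have hne : ∀ d : G.Dart, d.fst ∈ c.supp → d ∉ P.outer → s d ≠ 0 := fun d hd hdo => by
    simp only [s, if_pos (And.intro hdo hd)]
    exact one_ne_zero
  refine ⟨B, t, fun d hd => ⟨fun hdo => ht d ((hmemw d).2 ⟨hdo, hd⟩),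
    fun hdo => (hcut s hs).1 d (hne d hd hdo), fun hdo hdo' =>
    (hcut s hs).2 d (hne d hd hdo) (hne d.symm ((hsnd d).2 hd) hdo')⟩⟩

open Classical in
theorem exists_faceCut [Finite V] :
    ∃ (B : Set V) (t : V → ZMod 2), ∀ d : G.Dart,
      (d ∈ P.outer → t d.snd = t d.fst + B.indicator 1 d.snd) ∧
      (d ∉ P.outer → P.FaceCut B d) ∧
      (d ∉ P.outer → d.symm ∉ P.outer → ¬(d.fst ∈ B ∧ d.snd ∈ B)) := by
  choose B t h using P.exists_faceCut_component
  refine ⟨{v | v ∈ B (G.connectedComponentMk v)}, fun v => t (G.connectedComponentMk v) v,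
    fun d => ?_⟩
  obtain ⟨h1, h2, h3⟩ := h (G.connectedComponentMk d.fst) d rfl
  have hsnd : G.connectedComponentMk d.snd = G.connectedComponentMk d.fst :=
    ConnectedComponent.sound d.adj.symm.reachable
  refine ⟨fun hd => ?_, fun hd => (h2 hd).congr ?_, fun hd hd' => ?_⟩
  · beta_reduce
    rw [hsnd, h1 hd]
    simp only [Set.indicator_apply, Set.mem_ofPred_eq, hsnd]
  · ext z
    simp only [Set.mem_inter_iff, Set.mem_ofPred_eq, and_congr_right_iff]
    rintro ⟨e, he, rfl⟩
    have : G.connectedComponentMk e.fst = G.connectedComponentMk d.fst :=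
      ConnectedComponent.sound (P.reachable_of_mem_facialWalk he).symm
    rw [this]
  · simp only [Set.mem_ofPred_eq, hsnd]
    exact h3 hd hd'

variable {P}

/-- The two sides of a chord of a cycle are inner faces. -/
theorem Encloses.notMem_outer_of_common {L₁ L₂ : List (Sym2 V)} {s₁ s₂ : G.Dart → ZMod 2}
    (h₁ : P.Encloses L₁ s₁) (h₂ : P.Encloses L₂ s₂) (hL₁ : L₁.Nodup) (hL₂ : L₂.Nodup)
    {d : G.Dart} (hd₁ : d.edge ∈ L₁) (hd₂ : d.edge ∈ L₂)
    (hF : ∀ e, s₁ e ≠ 0 → s₂ e ≠ 0 → P.faceSet e ⊆ {d.fst, d.snd}) : d ∉ P.outer := by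
  intro hd
  -- If `d` were outer, both walks would enclose the face of `d.symm`. With no vertices but the ends
  -- of `d`, that face would turn back into `d`, which is not enclosed.
  have hne₁ := (h₁.ne_zero_or_symm hL₁ hd₁).resolve_left (not_not.2 (h₁.outer d hd))
  have hne₂ := (h₂.ne_zero_or_symm hL₂ hd₂).resolve_left (not_not.2 (h₂.outer d hd))
  have hstep := hF _ hne₁ hne₂
  have hsnd : (P.faceStep d.symm).snd ∈ ({d.fst, d.snd} : Set V) :=
    hstep (P.faceSet_faceStep d.symm ▸ P.snd_mem_faceSet _)
  have hfst : (P.faceStep d.symm).fst = d.fst := P.fst_faceStep d.symm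
  have heq : P.faceStep d.symm = d := by
    refine Dart.ext _ _ (Prod.ext hfst (hsnd.resolve_left fun h => ?_))
    exact (P.faceStep d.symm).fst_ne_snd (hfst.trans h.symm)
  refine hne₁ ?_
  rw [← h₁.faceStep, heq, h₁.outer d hd]

variable {B : Set V}

/-- Induction over chords. A chord has inner faces on both sides, so one of its ends is outside `B`
and connects the two pieces. -/
theorem connected_induce_path_diff [Finite V] (hB : ∀ d, d ∉ P.outer → P.FaceCut B d)
    (hB' : ∀ d : G.Dart, d ∉ P.outer → d.symm ∉ P.outer → ¬(d.fst ∈ B ∧ d.snd ∈ B)) (n : ℕ) :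
    ∀ {u v : V} {q : G.Walk u v} {h : G.Adj v u}, q.length = n → (Walk.cons h q).IsCycle →
      (G.induce ({x | x ∈ q.support} \ B)).Connected := by
  induction n using Nat.strong_induction_on with
  | _ n ih =>
  intro u v q h hn hc
  obtain ⟨s, hs⟩ := P.exists_encloses (Walk.cons h q)
  have hL := hc.isCircuit.isTrail.edges_nodup
  by_cases hch : (Walk.cons h q).IsChordless
  · have key : ∀ d, s d ≠ 0 → (G.induce ({x | x ∈ q.support} \ B)).Connected := by
      intro d hd
      rw [← hs.faceSet_eq_of_isChordless hc hch hd]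
      exact (hB d (hs.notMem_outer hd)).2
    rcases hs.ne_zero_or_symm (d := ⟨(v, u), h⟩) hL (by simp) with hd | hd
    · exact key _ hd
    · exact key _ hd
  · rw [Walk.IsChordless] at hch
    push Not at hch
    obtain ⟨e, he⟩ := hch
    have hq := Walk.isPath_of_isCycle_cons hc
    obtain ⟨a, b, q₁, q₂, q₃, rfl, hab, hl, hl'⟩ := Walk.exists_append_of_isChord he
    obtain ⟨s₁, s₂, h₁, h₂, -⟩ := hs.exists_split hab
    simp only [Walk.length_append] at hl' hn
    have hc₁ : (Walk.cons h (q₁.append (Walk.cons hab q₃))).IsCycle :=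
      Walk.isCycle_cons_of_two_le (Walk.isPath_shortcut hq hab) h (by simp; omega)
    have hc₂ : (Walk.cons hab.symm q₂).IsCycle :=
      Walk.isCycle_cons_of_two_le hq.of_append_right.of_append_left hab.symm hl
    have hL₁ := hc₁.isCircuit.isTrail.edges_nodup
    have hL₂ := hc₂.isCircuit.isTrail.edges_nodup
    have hF : ∀ e, s₁ e ≠ 0 → s₂ e ≠ 0 → P.faceSet e ⊆ {a, b} := by
      intro e he₁ he₂ z hz
      exact Walk.mem_support_inter_of_isPath hq
        ((Walk.support_cons_eq _ h ▸ h₁.faceSet_subset he₁) hz)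
        ((Walk.support_cons_eq _ hab.symm ▸ h₂.faceSet_subset he₂) hz)
    have hd : (⟨(a, b), hab⟩ : G.Dart) ∉ P.outer :=
      h₁.notMem_outer_of_common h₂ hL₁ hL₂ (by simp) (by simp) hF
    have hd' : (⟨(a, b), hab⟩ : G.Dart).symm ∉ P.outer :=
      h₁.notMem_outer_of_common h₂ hL₁ hL₂ (by simp) (by simp) fun e he₁ he₂ => by
        rw [Set.pair_comm]
        exact hF e he₁ he₂
    have h3 := ih _ (by simp; omega) rfl hc₁
    have h4 := ih _ (by omega) rfl hc₂
    have hunion : {x | x ∈ (q₁.append (q₂.append q₃)).support} \ B =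
        ({x | x ∈ (q₁.append (Walk.cons hab q₃)).support} \ B) ∪ ({x | x ∈ q₂.support} \ B) := by
      rw [← Set.union_sdiff_distrib]
      congr 1
      ext z
      simp only [Set.mem_union, Set.mem_ofPred_eq, Walk.mem_support_append_iff, Walk.support_cons,
        List.mem_cons]
      constructor
      · tauto
      · rintro ((hz | rfl | hz) | hz)
        · exact Or.inl hz
        · exact Or.inl (Walk.end_mem_support _)
        · exact Or.inr (Or.inr hz)
        · exact Or.inr (Or.inl hz)
    rw [hunion]
    refine induce_union_connected h3.preconnected h4.preconnected ?_
    by_cases ha : a ∈ B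
    · have hb : b ∉ B := fun hb => hB' _ hd hd' ⟨ha, hb⟩
      exact ⟨b, ⟨by simp, hb⟩, Walk.end_mem_support _, hb⟩
    · exact ⟨a, ⟨by simp, ha⟩, Walk.start_mem_support _, ha⟩

theorem connected_induce_cycle_diff [Finite V] (hB : ∀ d, d ∉ P.outer → P.FaceCut B d)
    (hB' : ∀ d : G.Dart, d ∉ P.outer → d.symm ∉ P.outer → ¬(d.fst ∈ B ∧ d.snd ∈ B))
    {v : V} {c : G.Walk v v} (hc : c.IsCycle) :
    (G.induce ({x | x ∈ c.support} \ B)).Connected := by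
  cases c with
  | nil => simp at hc
  | cons h q =>
    rw [Walk.support_cons_eq q h]
    exact connected_induce_path_diff hB hB' _ rfl hc

/-- Two cycles with a common edge have a common vertex outside `B`. -/
theorem exists_mem_support_notMem [Finite V] (hB : ∀ d, d ∉ P.outer → P.FaceCut B d)
    (hB' : ∀ d : G.Dart, d ∉ P.outer → d.symm ∉ P.outer → ¬(d.fst ∈ B ∧ d.snd ∈ B))
    {v₁ v₂ : V} {c₁ : G.Walk v₁ v₁} {c₂ : G.Walk v₂ v₂} (hc₁ : c₁.IsCycle) (hc₂ : c₂.IsCycle)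
    {d : G.Dart} (hd₁ : d.edge ∈ c₁.edges) (hd₂ : d.edge ∈ c₂.edges) :
    ∃ z ∉ B, z ∈ c₁.support ∧ z ∈ c₂.support := by
  obtain ⟨s₁, h₁⟩ := P.exists_encloses c₁
  obtain ⟨s₂, h₂⟩ := P.exists_encloses c₂
  have key : ∀ d : G.Dart, d.edge ∈ c₁.edges → d.edge ∈ c₂.edges → d ∈ P.outer →
      ∃ z ∉ B, z ∈ c₁.support ∧ z ∈ c₂.support := by
    intro d hd₁ hd₂ hd
    -- Since `d` is outer, both cycles enclose the face on its other side, and that face has a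
    -- vertex outside `B`.
    have hne₁ := (h₁.ne_zero_or_symm hc₁.isCircuit.isTrail.edges_nodup hd₁).resolve_left
      (not_not.2 (h₁.outer d hd))
    have hne₂ := (h₂.ne_zero_or_symm hc₂.isCircuit.isTrail.edges_nodup hd₂).resolve_left
      (not_not.2 (h₂.outer d hd))
    obtain ⟨z, hz, hzB⟩ := (hB _ (h₁.notMem_outer hne₁)).2.nonempty
    exact ⟨z, hzB, h₁.faceSet_subset hne₁ hz, h₂.faceSet_subset hne₂ hz⟩
  by_cases hd : d ∈ P.outer
  · exact key d hd₁ hd₂ hd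
  by_cases hd' : d.symm ∈ P.outer
  · exact key d.symm (by simpa using hd₁) (by simpa using hd₂) hd'
  by_cases hf : d.fst ∈ B
  · exact ⟨d.snd, fun hs => hB' d hd hd' ⟨hf, hs⟩, c₁.snd_mem_support_of_mem_edges hd₁,
      c₂.snd_mem_support_of_mem_edges hd₂⟩
  · exact ⟨d.fst, hf, c₁.fst_mem_support_of_mem_edges hd₁, c₂.fst_mem_support_of_mem_edges hd₂⟩

/-- A cycle encloses an inner face with all its vertices on the cycle, and every inner face meets
`B`. -/
theorem isAcyclic_induce_diff [Finite V] (hB : ∀ d, d ∉ P.outer → P.FaceCut B d) (H : Set V) :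
    (G.induce (H \ B)).IsAcyclic := by
  intro v c hc
  let f := (Embedding.induce (G := G) (H \ B)).toHom
  have hc' : (c.map f).IsCycle := hc.map Subtype.val_injective
  obtain ⟨s, hs⟩ := P.exists_encloses (c.map f)
  have key : ∀ d, s d = 0 := by
    intro d
    by_contra hd
    obtain ⟨z, hz, hzB⟩ := (hB d (hs.notMem_outer hd)).1
    have := hs.faceSet_subset hd hz
    rw [Set.mem_ofPred_eq, Walk.support_map, List.mem_map] at this
    obtain ⟨⟨y, hy⟩, -, rfl⟩ := this
    exact hy.2 hzB
  generalize c.map f = c' at hc' hs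
  cases c' with
  | nil => simp at hc'
  | @cons _ b _ h q =>
    rcases hs.ne_zero_or_symm (d := ⟨(_, b), h⟩) hc'.isCircuit.isTrail.edges_nodup (by simp)
      with hd | hd
    · exact hd (key _)
    · exact hd (key _)

end OuterplaneEmbedding

/-! ### Cycles in 2-connected sets -/

namespace SimpleGraph

variable {V : Type*} {G : SimpleGraph V} {H : Set V}

/-- In a set that induces a 2-connected graph, two vertices other than `y` are joined by a path
that avoids `y`. -/
theorem IsKVertexConnected.exists_path (hH : (G.induce H).IsKVertexConnected 2) {y a c : V}
    (ha : a ∈ H) (hc : c ∈ H) (hay : a ≠ y) (hcy : c ≠ y) :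
    ∃ q : G.Walk a c, q.IsPath ∧ ∀ z ∈ q.support, z ∈ H ∧ z ≠ y := by
  classical
  let S : Set H := {z | z.1 = y}
  have hS : S.ncard < 2 := by
    have hsub : S.Subsingleton := fun z hz z' hz' => Subtype.ext (hz.trans hz'.symm)
    have := (Set.ncard_le_one hsub.finite).2 fun z hz z' hz' => hsub hz hz'
    omega
  obtain ⟨w⟩ := (hH.2 S hS).preconnected ⟨⟨a, ha⟩, hay⟩ ⟨⟨c, hc⟩, hcy⟩
  let f : (G.induce H).induce Sᶜ →g G :=
    (Embedding.induce (G := G) H).toHom.comp (Embedding.induce (G := G.induce H) Sᶜ).toHom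
  refine ⟨(w.map f).bypass, Walk.bypass_isPath _, fun z hz => ?_⟩
  have := (w.map f).support_bypass_subset_support hz
  rw [Walk.support_map, List.mem_map] at this
  obtain ⟨x, -, rfl⟩ := this
  exact ⟨x.1.2, x.2⟩

theorem IsKVertexConnected.exists_adj (hH : (G.induce H).IsKVertexConnected 2) {y a : V}
    (hy : y ∈ H) (hay : a ≠ y) : ∃ c ∈ H, c ≠ a ∧ G.Adj y c := by
  have hcard : 2 < H.ncard := by
    have := hH.1
    rwa [Nat.card_coe_set_eq] at this
  obtain ⟨z, hz, hzn⟩ : ∃ z ∈ H, z ∉ ({a, y} : Set V) := by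
    by_contra! h
    have := Set.ncard_le_ncard (s := H) (t := {a, y}) h (Set.toFinite _)
    have := Set.ncard_insert_le a {y}
    rw [Set.ncard_singleton] at this
    omega
  rw [Set.mem_insert_iff, Set.mem_singleton_iff, not_or] at hzn
  obtain ⟨q, -, hq⟩ := hH.exists_path hy hz hay.symm hzn.1
  cases q with
  | nil => exact absurd rfl hzn.2
  | @cons _ c _ h p =>
    have hcs := hq c (by simp)
    exact ⟨c, hcs.1, hcs.2, h⟩

/-- A path from `a` to `c` avoiding `y` closes up through `y`. Such cycles link two given cycles
that meet at `y`. -/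
theorem IsKVertexConnected.exists_cycle (hH : (G.induce H).IsKVertexConnected 2) {y a c : V}
    (hy : y ∈ H) (ha : a ∈ H) (hc : c ∈ H) (hya : G.Adj y a) (hyc : G.Adj y c) (hac : a ≠ c) :
    ∃ w : G.Walk y y, w.IsCycle ∧ (∀ z ∈ w.support, z ∈ H) ∧ s(y, a) ∈ w.edges ∧
      s(y, c) ∈ w.edges := by
  obtain ⟨q, hq, hqs⟩ := hH.exists_path ha hc hya.ne' hyc.ne'
  have hpos : 0 < q.length := by
    cases q with
    | nil => exact absurd rfl hac
    | cons => simp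
  refine ⟨Walk.cons hya (q.concat hyc.symm), ?_, ?_, by simp, ?_⟩
  · refine Walk.isCycle_cons_of_two_le (hq.concat (fun h => (hqs y h).2 rfl) _) _ ?_
    rw [Walk.length_concat]
    omega
  · intro z hz
    rw [Walk.support_cons, Walk.support_concat, List.mem_cons, List.mem_append,
      List.mem_singleton] at hz
    rcases hz with rfl | hz | rfl
    · exact hy
    · exact (hqs z hz).1
    · exact hy
  · rw [Walk.edges_cons, Walk.edges_concat]
    simp [Sym2.eq_swap]

end SimpleGraph

/-! ### Connectedness of the components without `B`, and parity of the cycles -/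

namespace OuterplaneEmbedding

open SimpleGraph

variable {V : Type*} {G : SimpleGraph V} {P : OuterplaneEmbedding G}

/-- What is left of each cycle is connected, and cycles with a common edge share a vertex outside
`B`. Two cycles that meet in a vertex `y` are linked by a third one through an edge of each at `y`.
Since every edge inside `H` lies on a cycle inside `H`, a walk in `H` links any two cycles. -/
theorem connected_induce_diff [Finite V] {B : Set V} (hB : ∀ d, d ∉ P.outer → P.FaceCut B d)
    (hB' : ∀ d : G.Dart, d ∉ P.outer → d.symm ∉ P.outer → ¬(d.fst ∈ B ∧ d.snd ∈ B))
    {H : Set V} (hH : (G.induce H).IsKVertexConnected 2) : (G.induce (H \ B)).Connected := by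
  let r : V → V → Prop := fun x x' => ∃ (hx : x ∈ H \ B) (hx' : x' ∈ H \ B),
    (G.induce (H \ B)).Reachable ⟨x, hx⟩ ⟨x', hx'⟩
  have htrans : ∀ {x y z}, r x y → r y z → r x z := fun ⟨hx, _, h⟩ ⟨_, hz, h'⟩ =>
    ⟨hx, hz, h.trans h'⟩
  have hcyc : ∀ {v : V} {c : G.Walk v v}, c.IsCycle → (∀ z ∈ c.support, z ∈ H) →
      ∀ {x x'}, x ∈ c.support → x ∉ B → x' ∈ c.support → x' ∉ B → r x x' := by
    intro v c hc hcH x x' hx hxB hx' hxB'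
    have hsub : {x | x ∈ c.support} \ B ⊆ H \ B := fun z hz => ⟨hcH z hz.1, hz.2⟩
    have := (connected_induce_cycle_diff hB hB' hc).preconnected ⟨x, hx, hxB⟩ ⟨x', hx', hxB'⟩
    exact ⟨hsub ⟨hx, hxB⟩, hsub ⟨hx', hxB'⟩, this.map (induceHomOfLE G hsub).toHom⟩
  have hedge : ∀ {v₁ v₂ : V} {c₁ : G.Walk v₁ v₁} {c₂ : G.Walk v₂ v₂}, c₁.IsCycle → c₂.IsCycle →
      (∀ z ∈ c₁.support, z ∈ H) → (∀ z ∈ c₂.support, z ∈ H) → ∀ {y a}, s(y, a) ∈ c₁.edges →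
      s(y, a) ∈ c₂.edges → ∀ {x x'}, x ∈ c₁.support → x ∉ B → x' ∈ c₂.support → x' ∉ B →
      r x x' := by
    intro v₁ v₂ c₁ c₂ hc₁ hc₂ hH₁ hH₂ y a he₁ he₂ x x' hx hxB hx' hxB'
    obtain ⟨z, hzB, hz₁, hz₂⟩ := exists_mem_support_notMem hB hB' hc₁ hc₂
      (d := ⟨(y, a), c₁.adj_of_mem_edges he₁⟩) he₁ he₂
    exact htrans (hcyc hc₁ hH₁ hx hxB hz₁ hzB) (hcyc hc₂ hH₂ hz₂ hzB hx' hxB')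
  have hinc : ∀ {v : V} {c : G.Walk v v}, c.IsCycle → ∀ {y}, y ∈ c.support →
      ∃ a, s(y, a) ∈ c.edges := by
    intro v c hc y hy
    have := hc.ncard_neighborSet_toSubgraph_eq_two hy
    obtain ⟨a, ha⟩ := Set.nonempty_of_ncard_ne_zero (by omega :
      (c.toSubgraph.neighborSet y).ncard ≠ 0)
    exact ⟨a, Walk.adj_toSubgraph_iff_mem_edges.1 ha⟩
  have hvert : ∀ {v₁ v₂ : V} {c₁ : G.Walk v₁ v₁} {c₂ : G.Walk v₂ v₂}, c₁.IsCycle → c₂.IsCycle →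
      (∀ z ∈ c₁.support, z ∈ H) → (∀ z ∈ c₂.support, z ∈ H) → ∀ {y}, y ∈ c₁.support →
      y ∈ c₂.support → ∀ {x x'}, x ∈ c₁.support → x ∉ B → x' ∈ c₂.support → x' ∉ B →
      r x x' := by
    intro v₁ v₂ c₁ c₂ hc₁ hc₂ hH₁ hH₂ y hy₁ hy₂ x x' hx hxB hx' hxB'
    obtain ⟨a, ha⟩ := hinc hc₁ hy₁
    obtain ⟨b, hb⟩ := hinc hc₂ hy₂
    by_cases hab : a = b
    · subst hab
      exact hedge hc₁ hc₂ hH₁ hH₂ ha hb hx hxB hx' hxB'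
    · obtain ⟨c₃, hc₃, hH₃, ha₃, hb₃⟩ := hH.exists_cycle (hH₁ y hy₁)
        (hH₁ a (c₁.snd_mem_support_of_mem_edges ha)) (hH₂ b (c₂.snd_mem_support_of_mem_edges hb))
        (c₁.adj_of_mem_edges ha) (c₂.adj_of_mem_edges hb) hab
      obtain ⟨z, hz, hzB⟩ := (connected_induce_cycle_diff hB hB' hc₃).nonempty
      exact htrans (hedge hc₁ hc₃ hH₁ hH₃ ha ha₃ hx hxB hz hzB)
        (hedge hc₃ hc₂ hH₃ hH₂ hb₃ hb hz hzB hx' hxB')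
  have hexists : ∀ {y a}, y ∈ H → a ∈ H → G.Adj y a → ∃ c : G.Walk y y, c.IsCycle ∧
      (∀ z ∈ c.support, z ∈ H) ∧ a ∈ c.support := by
    intro y a hy ha hya
    obtain ⟨b, hb, hba, hyb⟩ := hH.exists_adj hy hya.ne'
    obtain ⟨c, hc, hcH, hac, -⟩ := hH.exists_cycle hy ha hb hya hyb hba.symm
    exact ⟨c, hc, hcH, c.snd_mem_support_of_mem_edges hac⟩
  have hcycle : ∀ {y}, y ∈ H → ∃ c : G.Walk y y, c.IsCycle ∧ ∀ z ∈ c.support, z ∈ H := by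
    intro y hy
    have h1 : 1 < H.ncard := by
      have := hH.1
      rw [Nat.card_coe_set_eq] at this
      omega
    obtain ⟨z, hz, hzy⟩ := Set.exists_ne_of_one_lt_ncard h1 y
    obtain ⟨a, ha, -, hya⟩ := hH.exists_adj hy hzy
    obtain ⟨c, hc, hcH, -⟩ := hexists hy ha hya
    exact ⟨c, hc, hcH⟩
  have hmain : ∀ {y y' : H} (w : (G.induce H).Walk y y') {v₁ v₂ : V} {c₁ : G.Walk v₁ v₁}
      {c₂ : G.Walk v₂ v₂}, c₁.IsCycle → c₂.IsCycle → (∀ z ∈ c₁.support, z ∈ H) →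
      (∀ z ∈ c₂.support, z ∈ H) → y.1 ∈ c₁.support → y'.1 ∈ c₂.support →
      ∀ {x x'}, x ∈ c₁.support → x ∉ B → x' ∈ c₂.support → x' ∉ B → r x x' := by
    intro y y' w
    induction w with
    | nil =>
      intro v₁ v₂ c₁ c₂ hc₁ hc₂ hH₁ hH₂ hy hy' x x' hx hxB hx' hxB'
      exact hvert hc₁ hc₂ hH₁ hH₂ hy hy' hx hxB hx' hxB'
    | @cons y b y' h p ih =>
      intro v₁ v₂ c₁ c₂ hc₁ hc₂ hH₁ hH₂ hy hy' x x' hx hxB hx' hxB'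
      obtain ⟨c₃, hc₃, hH₃, hb⟩ := hexists y.2 b.2 h
      obtain ⟨z, hz, hzB⟩ := (connected_induce_cycle_diff hB hB' hc₃).nonempty
      exact htrans (hvert hc₁ hc₃ hH₁ hH₃ hy c₃.start_mem_support hx hxB hz hzB)
        (ih hc₃ hc₂ hH₃ hH₂ hb hy' hz hzB hx' hxB')
  have hpre : (G.induce H).Preconnected := by
    intro y y'
    by_cases hyy : y = y'
    · rw [hyy]
    · obtain ⟨a, -, hay, hya⟩ := hH.exists_adj y.2 (a := y'.1) fun h => hyy (Subtype.ext h.symm)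
      obtain ⟨q, -, hq⟩ := hH.exists_path y.2 y'.2 hya.ne hay.symm
      exact ⟨q.induce H fun z hz => (hq z hz).1⟩
  have hr : ∀ x x', x ∈ H \ B → x' ∈ H \ B → r x x' := by
    rintro x x' ⟨hx, hxB⟩ ⟨hx', hxB'⟩
    obtain ⟨c₁, hc₁, hH₁⟩ := hcycle hx
    obtain ⟨c₂, hc₂, hH₂⟩ := hcycle hx'
    obtain ⟨w⟩ := hpre ⟨x, hx⟩ ⟨x', hx'⟩
    exact hmain w hc₁ hc₂ hH₁ hH₂ c₁.start_mem_support c₂.start_mem_support c₁.start_mem_support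
      hxB c₂.start_mem_support hxB'
  have hne : (H \ B).Nonempty := by
    obtain ⟨y, hy⟩ : H.Nonempty := by
      have := hH.1
      rw [Nat.card_coe_set_eq] at this
      exact Set.nonempty_of_ncard_ne_zero (by omega)
    obtain ⟨c, hc, hcH⟩ := hcycle hy
    obtain ⟨z, hz, hzB⟩ := (connected_induce_cycle_diff hB hB' hc).nonempty
    exact ⟨z, hcH z hz, hzB⟩
  have := hne.to_subtype
  exact ⟨fun x x' => (hr x x' x.2 x'.2).2.2⟩

open Classical in
-- The potential is constant until the walk steps into `B` again, and that step adds 1.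
theorem NextVisit.apply_fst_eq {B : Set V} {t : V → ZMod 2}
    (ht : ∀ d ∈ P.outer, t d.snd = t d.fst + B.indicator 1 d.snd) {d e : G.Dart}
    (hd : d ∈ P.outer) (h : P.NextVisit B d e) : t e.fst = t d.fst + 1 := by
  obtain ⟨-, he, n, hn, rfl, hm⟩ := h
  have hout : ∀ m, (P.faceStep ^ m) d ∈ P.outer := fun m => by
    rw [← Equiv.Perm.iterate_eq_pow]
    exact P.iterate_faceStep_mem_outer hd m
  have hstep : ∀ m, t ((P.faceStep ^ (m + 1)) d).fst =
      t ((P.faceStep ^ m) d).fst + B.indicator 1 ((P.faceStep ^ (m + 1)) d).fst := by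
    intro m
    rw [pow_succ', Equiv.Perm.mul_apply, P.fst_faceStep, ht _ (hout m)]
  have hconst : ∀ m < n, t ((P.faceStep ^ m) d).fst = t d.fst := by
    intro m
    induction m with
    | zero => simp
    | succ m ih =>
      intro hmn
      rw [hstep, ih (by omega), Set.indicator_of_notMem (hm _ (by omega) hmn), add_zero]
  obtain ⟨k, rfl⟩ := Nat.exists_eq_succ_of_ne_zero hn.ne'
  rw [Nat.succ_eq_add_one, hstep, hconst k (by omega), Set.indicator_of_mem he, Pi.one_apply]

end OuterplaneEmbedding

theorem mainTheorem5 {V : Type*} [Finite V] (G : SimpleGraph V) (P : OuterplaneEmbedding G) :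
    ∃ B : Set V, P.IsBlockingSet B ∧
      ∀ n : ℕ, (P.blockingGraph B).HasCycleOfLength n → Even n := by
  obtain ⟨B, t, h⟩ := P.exists_faceCut
  have hB := fun d => (h d).2.1
  have hB' := fun d => (h d).2.2
  refine ⟨B, ⟨fun H hH => ⟨OuterplaneEmbedding.connected_induce_diff hB hB' hH.prop,
    OuterplaneEmbedding.isAcyclic_induce_diff hB H⟩, ?_⟩, ?_⟩
  · rintro F ⟨d, hd, rfl⟩
    obtain ⟨z, hz⟩ := (hB d hd).2.nonempty
    exact ⟨z, hz⟩
  · rintro n ⟨hn, x, e, -, -, hlink⟩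
    have : NeZero n := ⟨hn.ne'⟩
    have hstep : ∀ i, t (x (i + 1)) = t (x i) + 1 := by
      intro i
      obtain ⟨hd, f, hf, hor⟩ := hlink i
      have h1 := hf.apply_fst_eq (fun d hd => (h d).1 hd) hd
      rcases hor with ⟨h2, h3⟩ | ⟨h2, h3⟩
      · rw [h2, h3, h1]
      · rw [h2, h3, h1, add_assoc, CharTwo.add_self_eq_zero, add_zero]
    -- Summing the increments around the cycle gives `n = 0` in `ZMod 2`; loops and parallel edges
    -- need no separate treatment.
    have hsum : ∑ i, t (x (i + 1)) = ∑ i, t (x i) :=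
      Equiv.sum_comp (Equiv.addRight (1 : ZMod n)) fun i => t (x i)
    simp_rw [hstep] at hsum
    rw [Finset.sum_add_distrib, add_eq_left, Finset.sum_const, Finset.card_univ, ZMod.card,
      nsmul_one] at hsum
    exact (ZMod.natCast_eq_zero_iff_even).1 hsum
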